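/- Let $M$ be a connected smooth (Hausdorff, second countable) $3$-dimensional manifold with a smooth Riemannian metric $g$, and let $x : (M,g)\to\mathbb E^4$ be a smooth isometric immersion into Euclidean $4$-space. Let $\Delta$ be the Laplace operator of $(M,g)$, given in local coordinates by $$\Delta f=-\frac1{\sqrt{\det (g_{kl})}}\sum_{i,j}\partial_i\Big(\sqrt{\det (g_{kl})}\,g^{ij}\,\partial_j f\Big)$$ and acting componentwise on $\mathbb E^4$-valued maps, and let $L=\Delta x : M\to\mathbb E^4$ be the Laplace map of $x$. The Laplace transformation $M\to L(M)$, $p\mapsto L(p)$, is called homothetic if there is a constant $c>0$ such that $$\langle dL(X),dL(Y)\rangle=c^2\,g(X,Y)$$ for all $p\in M$ and all $X,Y\in T_pM$. Then the Laplace transformation of $x$ is homothetic if and only if the hypersurface is an open part of a hypersphere of $\mathbb E^4$, that is, if and only if $x(M)$ is a relatively open subset of a hypersphere $\{y\in\mathbb E^4 : |y-a|=r\}$ for some $a\in\mathbb E^4$ and $r>0$. -/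

import Mathlib

open scoped Manifold ContDiff

noncomputable section

/-- Euclidean `n`-space. -/
abbrev Eucl (n : ℕ) : Type := EuclideanSpace ℝ (Fin n)

/-- A smooth Riemannian metric on an `n`-dimensional smooth manifold `M`. -/
abbrev SmoothMetric (n : ℕ) (M : Type*) [TopologicalSpace M] [ChartedSpace (Eucl n) M]
    [IsManifold (𝓡 n) ∞ M] : Type _ :=
  Bundle.ContMDiffRiemannianMetric (𝓡 n) ∞ (Eucl n) (fun p : M => TangentSpace (𝓡 n) p)

/-- The partial derivative `∂h/∂yᵢ` of a vector valued function on Euclidean space. -/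
def partialD {n m : ℕ} (i : Fin n) (h : Eucl n → Eucl m) (y : Eucl n) : Eucl m :=
  fderiv ℝ h y (EuclideanSpace.single i 1)

/-- The coordinate vector field `∂/∂yᵢ` of the chart around `p`, at the point with
coordinates `y`. -/
def coordVec {n : ℕ} {M : Type*} [TopologicalSpace M] [ChartedSpace (Eucl n) M]
    (p : M) (y : Eucl n) (i : Fin n) :
    TangentSpace (𝓡 n) ((extChartAt (𝓡 n) p).symm y) :=
  mfderiv 𝓘(ℝ, Eucl n) (𝓡 n) (extChartAt (𝓡 n) p).symm y
    (EuclideanSpace.single i (1 : ℝ) : Eucl n)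

/-- The matrix `(gᵢⱼ)` of the metric in the chart around `p`, at the point with coordinates `y`. -/
def metricMatrix {n : ℕ} {M : Type*} [TopologicalSpace M] [ChartedSpace (Eucl n) M]
    [IsManifold (𝓡 n) ∞ M] (g : SmoothMetric n M) (p : M) (y : Eucl n) :
    Matrix (Fin n) (Fin n) ℝ :=
  Matrix.of fun i j =>
    g.inner ((extChartAt (𝓡 n) p).symm y) (coordVec p y i) (coordVec p y j)

/-- The Laplace operator of the Riemannian manifold `(M, g)`, with the geometers' sign,
`Δf = - (det g)^(-1/2) ∑ᵢ ∂ᵢ (∑ⱼ (det g)^(1/2) gⁱʲ ∂ⱼ f)`, acting on maps into Euclidean space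
(componentwise). Its value at `p` is computed in the preferred chart around `p`. -/
def laplaceOp {n m : ℕ} {M : Type*} [TopologicalSpace M] [ChartedSpace (Eucl n) M]
    [IsManifold (𝓡 n) ∞ M] (g : SmoothMetric n M) (f : M → Eucl m) (p : M) : Eucl m :=
  -((Real.sqrt (metricMatrix g p (extChartAt (𝓡 n) p p)).det)⁻¹ •
    ∑ i, partialD i
      (fun y => ∑ j, (Real.sqrt (metricMatrix g p y).det * (metricMatrix g p y)⁻¹ i j) •
        partialD j (f ∘ (extChartAt (𝓡 n) p).symm) y)
      (extChartAt (𝓡 n) p p))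

/-- The differential `df : T_p M → 𝔼ᵐ` of a map `f : M → 𝔼ᵐ`. -/
def differential {n m : ℕ} {M : Type*} [TopologicalSpace M] [ChartedSpace (Eucl n) M]
    (f : M → Eucl m) (p : M) : TangentSpace (𝓡 n) p →L[ℝ] Eucl m :=
  mfderiv (𝓡 n) 𝓘(ℝ, Eucl m) f p

/-- `x : (M, g) → 𝔼ᵐ` is an isometric immersion: it is smooth and `⟨dx X, dx Y⟩ = g(X, Y)`
(so that `dx` is injective). -/
def IsIsometricImmersion {n m : ℕ} {M : Type*} [TopologicalSpace M] [ChartedSpace (Eucl n) M]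
    [IsManifold (𝓡 n) ∞ M] (g : SmoothMetric n M) (x : M → Eucl m) : Prop :=
  ContMDiff (𝓡 n) 𝓘(ℝ, Eucl m) ∞ x ∧
    ∀ (p : M) (X Y : TangentSpace (𝓡 n) p),
      inner ℝ (differential x p X) (differential x p Y) = g.inner p X Y

/-- The Laplace map `L = Δx` of `x : (M, g) → 𝔼ᵐ`. -/
def laplaceMap {n m : ℕ} {M : Type*} [TopologicalSpace M] [ChartedSpace (Eucl n) M]
    [IsManifold (𝓡 n) ∞ M] (g : SmoothMetric n M) (x : M → Eucl m) : M → Eucl m :=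
  fun p => laplaceOp g x p

/-- The Laplace transformation `M → L(M)`, `p ↦ L(p)`, is homothetic: there is a constant `c > 0`
with `⟨dL X, dL Y⟩ = c² g(X, Y)` for all tangent vectors `X`, `Y` at all points. -/
def HasHomotheticLaplaceTransformation {n m : ℕ} {M : Type*} [TopologicalSpace M]
    [ChartedSpace (Eucl n) M] [IsManifold (𝓡 n) ∞ M] (g : SmoothMetric n M)
    (x : M → Eucl m) : Prop :=
  ∃ c : ℝ, 0 < c ∧ ∀ (p : M) (X Y : TangentSpace (𝓡 n) p),
    inner ℝ (differential (laplaceMap g x) p X) (differential (laplaceMap g x) p Y) = c ^ 2 * g.inner p X Y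

/-- The image of `x` is an open part (a relatively open subset) of a hypersphere of `𝔼ᵐ`, of
arbitrary center and positive radius. -/
def IsOpenPartOfHypersphere {m : ℕ} {M : Type*} (x : M → Eucl m) : Prop :=
  ∃ (a : Eucl m) (r : ℝ), 0 < r ∧
    ∃ U : Set (Eucl m), IsOpen U ∧ Set.range x = Metric.sphere a r ∩ U

end

/-! By Beltrami's formula L = Δx is normal to the hypersurface, and |L|² is the trace of the mixed
form ⟨dx, dL⟩. If the Laplace transformation is homothetic with constant c, the field z = L/c is
normal to x, dz induces the same metric as dx, and the trace of ⟨dx, dz⟩ is c|z|². These local data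
form an `IsometricNormalPair`; the heart of the proof is `IsometricNormalPair.fderiv_eq`: dz = dx.
Then x - z is locally constant, hence a constant a, and the trace identity reads 3 = c|z|², so x
lies on the sphere about a of radius √(3/c).

To get dz = dx, split according to the rank of the second fundamental form of x.

Where it is nondegenerate, x and z are two hypersurfaces with equal metrics, hence equal Christoffel
symbols and curvature. The Gauss equation fixes the 2 × 2 minors of the second fundamental form, and
at rank 3 these fix the form up to sign. So dz = P ∘ dx with an isometry P
(`exists_isometry_of_gauss`), which is locally constant (`exists_local_isometry`). Symmetry of ⟨dx,
dz⟩ makes P self-adjoint, so P² = 1. The trace of P gives a quadratic equation with constant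
coefficients for |z|²; hence |z| is constant, z is an eigenvector of P, and P acts on tangent
vectors by one sign, which positivity of the trace makes +1 (`fderiv_eq_of_isometry`).

If dz ≠ dx at a point, the form is therefore degenerate on a whole neighbourhood. There the
tangential part of dz has eigenvalues ±1, ±1, 0 and positive trace, so the trace is 2
(`trace_of_degenerate`) and |z|² = 2/c is constant. A kernel vector of the form is then killed by
dz, against injectivity of dz.

Conversely, on a sphere of radius r about a one has Δx = (3/r²)(x - a), a homothety of x. An
immersion into a 3-sphere is open onto its image there by the inverse function theorem. -/

open scoped Manifold ContDiff

noncomputable section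

/-! ### The Laplacian of a parametrized hypersurface: normality, trace formula, independence of
coordinates. -/

section ChartLaplacian

lemma eucl_sum_single (v : Eucl 3) : v = ∑ i, v i • EuclideanSpace.single i (1 : ℝ) := by
  simpa using ((EuclideanSpace.basisFun (Fin 3) ℝ).sum_repr v).symm

lemma contDiffAt_partialD {n m : ℕ} {X : Eucl n → Eucl m} {y : Eucl n}
    (h : ContDiffAt ℝ ∞ X y) (i : Fin n) : ContDiffAt ℝ ∞ (partialD i X) y :=
  (h.fderiv_right (m := ∞) (by simp)).clm_apply contDiffAt_const

lemma fderiv_partialD {n m : ℕ} {X : Eucl n → Eucl m} {y : Eucl n}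
    (h : ContDiffAt ℝ ∞ X y) (i : Fin n) (v : Eucl n) :
    fderiv ℝ (partialD i X) y v = fderiv ℝ (fderiv ℝ X) y v (EuclideanSpace.single i 1) := by
  have h1 : DifferentiableAt ℝ (fderiv ℝ X) y :=
    (h.fderiv_right (m := ∞) (by simp)).differentiableAt (by simp)
  have := (h1.hasFDerivAt.clm_apply (hasFDerivAt_const (EuclideanSpace.single i (1 : ℝ)) y)).fderiv
  unfold partialD
  rw [this]
  simp

lemma fderiv_fderiv_symm {E F : Type*} [NormedAddCommGroup E] [NormedSpace ℝ E]
    [NormedAddCommGroup F] [NormedSpace ℝ F] {X : E → F} {y : E}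
    (h : ContDiffAt ℝ ∞ X y) (u v : E) :
    fderiv ℝ (fderiv ℝ X) y u v = fderiv ℝ (fderiv ℝ X) y v u :=
  (h.isSymmSndFDerivAt (by simpa using (WithTop.coe_le_coe.2 (le_top : (2 : ℕ∞) ≤ ⊤)))).eq u v

/-- The Gram matrix of the coordinate tangent vectors of a parametrized hypersurface. -/
def coordGram (X : Eucl 3 → Eucl 4) (y : Eucl 3) : Matrix (Fin 3) (Fin 3) ℝ :=
  Matrix.of fun i j => inner ℝ (partialD i X y) (partialD j X y)

/-- The Laplace operator of the induced metric of a parametrized hypersurface, applied to the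
parametrization. -/
def chartLap (X : Eucl 3 → Eucl 4) (y : Eucl 3) : Eucl 4 :=
  -((Real.sqrt (coordGram X y).det)⁻¹ •
    ∑ i, partialD i
      (fun y => ∑ j, (Real.sqrt (coordGram X y).det * (coordGram X y)⁻¹ i j) • partialD j X y) y)

lemma coordGram_det_pos {X : Eucl 3 → Eucl 4} {y : Eucl 3}
    (hinj : Function.Injective (fderiv ℝ X y)) : 0 < (coordGram X y).det := by
  have hli : LinearIndependent ℝ (fun i : Fin 3 => partialD i X y) := by
    have h1 : LinearIndependent ℝ (fun i : Fin 3 => (EuclideanSpace.single i (1 : ℝ) : Eucl 3)) := by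
      have h0 := (EuclideanSpace.basisFun (Fin 3) ℝ).orthonormal.linearIndependent
      rwa [show ⇑(EuclideanSpace.basisFun (Fin 3) ℝ) = fun i => EuclideanSpace.single i (1 : ℝ)
        from funext fun i => EuclideanSpace.basisFun_apply _ _ i] at h0
    exact h1.map' (fderiv ℝ X y).toLinearMap (LinearMap.ker_eq_bot.2 hinj)
  exact (Matrix.posDef_gram_of_linearIndependent hli).det_pos

lemma contDiffAt_coordGram {X : Eucl 3 → Eucl 4} {y : Eucl 3} (h : ContDiffAt ℝ ∞ X y)
    (i j : Fin 3) : ContDiffAt ℝ ∞ (fun y => coordGram X y i j) y :=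
  (contDiffAt_partialD h i).inner ℝ (contDiffAt_partialD h j)

lemma contDiffAt_coordGram_det {X : Eucl 3 → Eucl 4} {y : Eucl 3} (h : ContDiffAt ℝ ∞ X y) :
    ContDiffAt ℝ ∞ (fun y => (coordGram X y).det) y := by
  have := contDiffAt_coordGram h
  simp only [Matrix.det_fin_three]
  fun_prop

lemma contDiffAt_coordGram_inv {X : Eucl 3 → Eucl 4} {y : Eucl 3} (h : ContDiffAt ℝ ∞ X y)
    (hinj : Function.Injective (fderiv ℝ X y)) (i j : Fin 3) :
    ContDiffAt ℝ ∞ (fun y => (coordGram X y)⁻¹ i j) y := by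
  have h1 := contDiffAt_coordGram h
  have h2 : ContDiffAt ℝ ∞ (fun y => (coordGram X y).det⁻¹) y :=
    (contDiffAt_coordGram_det h).inv (coordGram_det_pos hinj).ne'
  simp only [Matrix.inv_def, Ring.inverse_eq_inv', Matrix.smul_apply, smul_eq_mul]
  refine h2.mul ?_
  simp only [Matrix.adjugate_fin_three]
  fin_cases i <;> fin_cases j <;> simp <;> fun_prop

lemma contDiffAt_sqrt_coordGram_det {X : Eucl 3 → Eucl 4} {y : Eucl 3} (h : ContDiffAt ℝ ∞ X y)
    (hinj : Function.Injective (fderiv ℝ X y)) :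
    ContDiffAt ℝ ∞ (fun y => Real.sqrt (coordGram X y).det) y :=
  (contDiffAt_coordGram_det h).sqrt (coordGram_det_pos hinj).ne'

lemma contDiffAt_gradient_density {X : Eucl 3 → Eucl 4} {y : Eucl 3} (h : ContDiffAt ℝ ∞ X y)
    (hinj : Function.Injective (fderiv ℝ X y)) (i : Fin 3) :
    ContDiffAt ℝ ∞ (fun y => ∑ j, (Real.sqrt (coordGram X y).det * (coordGram X y)⁻¹ i j) •
      partialD j X y) y :=
  ContDiffAt.sum fun j _ => ((contDiffAt_sqrt_coordGram_det h hinj).mul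
    (contDiffAt_coordGram_inv h hinj i j)).smul (contDiffAt_partialD h j)

lemma contDiffAt_chartLap {X : Eucl 3 → Eucl 4} {y : Eucl 3} (h : ContDiffAt ℝ ∞ X y)
    (hinj : Function.Injective (fderiv ℝ X y)) : ContDiffAt ℝ ∞ (chartLap X) y := by
  refine ContDiffAt.neg (ContDiffAt.smul (𝕜 := ℝ)
    (f := fun y => (Real.sqrt (coordGram X y).det)⁻¹) ?_ ?_)
  · exact (contDiffAt_sqrt_coordGram_det h hinj).inv
      (Real.sqrt_pos.2 (coordGram_det_pos hinj)).ne'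
  · exact ContDiffAt.sum fun i _ => contDiffAt_partialD (contDiffAt_gradient_density h hinj i) i

/-- Jacobi's formula for the derivative of a determinant. -/
lemma fderiv_det_fin_three {E : Type*} [NormedAddCommGroup E] [NormedSpace ℝ E]
    {A : E → Matrix (Fin 3) (Fin 3) ℝ} {y : E}
    (h : ∀ i j, DifferentiableAt ℝ (fun y => A y i j) y) (v : E) :
    fderiv ℝ (fun y => (A y).det) y v =
      ∑ i, ∑ j, (A y).adjugate i j * fderiv ℝ (fun y => A y j i) y v := by
  have h' := fun i j => (h i j).hasFDerivAt
  have key := ((((((((h' 0 0).mul (h' 1 1)).mul (h' 2 2)).sub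
    (((h' 0 0).mul (h' 1 2)).mul (h' 2 1))).sub (((h' 0 1).mul (h' 1 0)).mul (h' 2 2))).add
    (((h' 0 1).mul (h' 1 2)).mul (h' 2 0))).add (((h' 0 2).mul (h' 1 0)).mul (h' 2 1))).sub
    (((h' 0 2).mul (h' 1 1)).mul (h' 2 0)))
  have e : (fun y => (A y).det) = _ := funext fun y => Matrix.det_fin_three (A y)
  rw [e]
  erw [key.fderiv]
  simp [Matrix.adjugate_fin_three, Fin.sum_univ_three]
  ring

/-- The fields `V i` = Σⱼ w gⁱʲ ∂ⱼX, with w = √det g, satisfy ⟨`V i`, ∂ₖX⟩ = w δᵢₖ. Differentiating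
and summing leaves ∂ₖw - Σᵢ ⟨`V i`, ∂ᵢ∂ₖX⟩, which vanishes by Jacobi's formula. -/
lemma inner_chartLap_tangent {X : Eucl 3 → Eucl 4} {y : Eucl 3} (h : ContDiffAt ℝ ∞ X y)
    (hinj : Function.Injective (fderiv ℝ X y)) (k : Fin 3) :
    inner ℝ (chartLap X y) (partialD k X y) = 0 := by
  set V : Fin 3 → Eucl 3 → Eucl 4 := fun i y =>
    ∑ j, (Real.sqrt (coordGram X y).det * (coordGram X y)⁻¹ i j) • partialD j X y with hV
  set w : Eucl 3 → ℝ := fun y => Real.sqrt (coordGram X y).det with hw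
  have hdet : ∀ᶠ z in nhds y, (coordGram X z).det ≠ 0 :=
    (contDiffAt_coordGram_det h).continuousAt.eventually_ne (coordGram_det_pos hinj).ne'
  have hVk : ∀ i, (fun z => inner ℝ (V i z) (partialD k X z)) =ᶠ[nhds y]
      fun z => if i = k then w z else 0 := by
    intro i
    filter_upwards [hdet] with z hz
    have h1 : ((coordGram X z)⁻¹ * coordGram X z) i k = if i = k then 1 else 0 := by
      rw [Matrix.nonsing_inv_mul _ (isUnit_iff_ne_zero.2 hz), Matrix.one_apply]
    rw [Matrix.mul_apply] at h1
    simp only [hV, sum_inner, real_inner_smul_left, mul_assoc]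
    rw [← Finset.mul_sum]
    have : ∑ j, (coordGram X z)⁻¹ i j * inner ℝ (partialD j X z) (partialD k X z) =
      if i = k then 1 else 0 := h1
    simp [this, hw]
  have hVd : ∀ i, DifferentiableAt ℝ (V i) y := fun i =>
    (contDiffAt_gradient_density h hinj i).differentiableAt (by simp)
  have hXd : ∀ i, DifferentiableAt ℝ (partialD i X) y := fun i =>
    (contDiffAt_partialD h i).differentiableAt (by simp)
  have hder : ∀ i, inner ℝ (partialD i (V i) y) (partialD k X y) =
      (if i = k then fderiv ℝ w y (EuclideanSpace.single i 1) else 0) -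
      inner ℝ (V i y) (fderiv ℝ (fderiv ℝ X) y (EuclideanSpace.single i 1)
        (EuclideanSpace.single k 1)) := by
    intro i
    have h1 := congrArg (fun T : Eucl 3 →L[ℝ] ℝ => T (EuclideanSpace.single i 1))
      ((hVk i).fderiv_eq (𝕜 := ℝ))
    simp only [fderiv_inner_apply ℝ (hVd i) (hXd k)] at h1
    rw [fderiv_partialD h] at h1
    have h2 : fderiv ℝ (fun z => if i = k then w z else 0) y (EuclideanSpace.single i 1) =
        if i = k then fderiv ℝ w y (EuclideanSpace.single i 1) else 0 := by
      split_ifs <;> simp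
    rw [h2] at h1
    change inner ℝ (fderiv ℝ (V i) y (EuclideanSpace.single i 1)) _ = _
    linarith
  have hdw : fderiv ℝ w y (EuclideanSpace.single k 1) = ∑ i, inner ℝ (V i y)
      (fderiv ℝ (fderiv ℝ X) y (EuclideanSpace.single i 1) (EuclideanSpace.single k 1)) := by
    have hpos := coordGram_det_pos hinj
    have hw0 : 0 < w y := Real.sqrt_pos.2 hpos
    have hww : w y * w y = (coordGram X y).det := Real.mul_self_sqrt hpos.le
    have h1 : fderiv ℝ w y (EuclideanSpace.single k 1) = 1 / (2 * w y) *
        fderiv ℝ (fun z => (coordGram X z).det) y (EuclideanSpace.single k 1) := by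
      have := ((contDiffAt_coordGram_det h).differentiableAt (by simp)).hasFDerivAt.sqrt hpos.ne'
      rw [hw, this.fderiv]
      simp
    rw [h1, fderiv_det_fin_three fun i j => (contDiffAt_coordGram h i j).differentiableAt (by simp)]
    have hadj : ∀ i j, (coordGram X y).adjugate i j = w y * w y * (coordGram X y)⁻¹ i j := by
      intro i j
      rw [hww, Matrix.inv_def, Ring.inverse_eq_inv', Matrix.smul_apply, smul_eq_mul,
        mul_inv_cancel_left₀ hpos.ne']
    have hG : ∀ i j, fderiv ℝ (fun z => coordGram X z j i) y (EuclideanSpace.single k 1) =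
        inner ℝ (partialD j X y) (fderiv ℝ (fderiv ℝ X) y (EuclideanSpace.single i 1)
          (EuclideanSpace.single k 1)) +
        inner ℝ (partialD i X y) (fderiv ℝ (fderiv ℝ X) y (EuclideanSpace.single j 1)
          (EuclideanSpace.single k 1)) := by
      intro i j
      change fderiv ℝ (fun z => inner ℝ (partialD j X z) (partialD i X z)) y _ = _
      rw [fderiv_inner_apply ℝ (hXd j) (hXd i), fderiv_partialD h, fderiv_partialD h,
        fderiv_fderiv_symm h _ (EuclideanSpace.single k 1),
        fderiv_fderiv_symm h _ (EuclideanSpace.single k 1), real_inner_comm (partialD i X y)]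
    have hsymm : ∀ i j, (coordGram X y)⁻¹ i j = (coordGram X y)⁻¹ j i := by
      intro i j
      have h3 : (coordGram X y).transpose = coordGram X y := by
        ext i j
        exact real_inner_comm (partialD i X y) (partialD j X y)
      have h4 : ((coordGram X y)⁻¹).transpose = (coordGram X y)⁻¹ := by
        rw [Matrix.transpose_nonsing_inv, h3]
      exact (congrFun (congrFun h4 i) j).symm
    simp only [hG, hadj, hV, sum_inner, real_inner_smul_left, mul_add,
      Finset.sum_add_distrib]
    rw [Finset.sum_comm (f := fun i j => w y * w y * (coordGram X y)⁻¹ i j *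
      inner ℝ (partialD i X y) _)]
    simp only [← Finset.sum_add_distrib, Finset.mul_sum]
    refine Finset.sum_congr rfl fun i _ => Finset.sum_congr rfl fun j _ => ?_
    rw [hsymm j i]
    change _ = w y * _ * _
    field_simp
    ring
  unfold chartLap
  rw [inner_neg_left, inner_smul_left, sum_inner]
  change -(_ * ∑ i, inner ℝ (partialD i (V i) y) (partialD k X y)) = 0
  simp only [hder, Finset.sum_sub_distrib, Finset.sum_ite_eq', Finset.mem_univ, if_true, hdw]
  simp

/-- Derivatives of the coefficients multiply tangent vectors, which ν annihilates; only the second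
derivatives of X survive. -/
lemma inner_chartLap_normal_coord {X : Eucl 3 → Eucl 4} {y : Eucl 3} (h : ContDiffAt ℝ ∞ X y)
    (hinj : Function.Injective (fderiv ℝ X y)) {ν : Eucl 4}
    (hν : ∀ u, inner ℝ (fderiv ℝ X y u) ν = 0) :
    inner ℝ (chartLap X y) ν = -∑ i, ∑ j, (coordGram X y)⁻¹ i j *
      inner ℝ (fderiv ℝ (fderiv ℝ X) y (EuclideanSpace.single i 1) (EuclideanSpace.single j 1)) ν := by
  have hw0 : 0 < Real.sqrt (coordGram X y).det := Real.sqrt_pos.2 (coordGram_det_pos hinj)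
  unfold chartLap
  rw [inner_neg_left, inner_smul_left, sum_inner, Finset.mul_sum]
  congr 1
  refine Finset.sum_congr rfl fun i _ => ?_
  unfold partialD
  have hd : ∀ j, DifferentiableAt ℝ
      (fun y => Real.sqrt (coordGram X y).det * (coordGram X y)⁻¹ i j) y := fun j =>
    ((contDiffAt_sqrt_coordGram_det h hinj).mul
      (contDiffAt_coordGram_inv h hinj i j)).differentiableAt (by simp)
  have hXd : ∀ i, DifferentiableAt ℝ (partialD i X) y := fun i =>
    (contDiffAt_partialD h i).differentiableAt (by simp)
  have := (HasFDerivAt.fun_sum (u := Finset.univ)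
    fun j _ => (hd j).hasFDerivAt.smul (hXd j).hasFDerivAt).fderiv
  unfold partialD at this
  erw [this]
  rw [sum_apply, sum_inner, Finset.mul_sum]
  refine Finset.sum_congr rfl fun j _ => ?_
  have e2 := fderiv_partialD h j (EuclideanSpace.single i 1)
  unfold partialD at e2
  simp only [add_apply, smul_apply,
    ContinuousLinearMap.smulRight_apply, inner_add_left, inner_smul_left, hν, e2]
  simp
  field_simp

/-- If the columns of U are the frame, orthonormality says UᵀGU = 1, so G⁻¹ = UUᵀ. -/
lemma sum_inv_coordGram {X : Eucl 3 → Eucl 4} {y : Eucl 3}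
    {u : Fin 3 → Eucl 3} (hu : Orthonormal ℝ fun k => fderiv ℝ X y (u k))
    (B : Eucl 3 →ₗ[ℝ] Eucl 3 →ₗ[ℝ] ℝ) :
    ∑ i, ∑ j, (coordGram X y)⁻¹ i j * B (EuclideanSpace.single i 1) (EuclideanSpace.single j 1) =
      ∑ k, B (u k) (u k) := by
  set U : Matrix (Fin 3) (Fin 3) ℝ := Matrix.of fun i k => u k i with hU
  have h1 : U.transpose * (coordGram X y * U) = 1 := by
    ext k l
    have := (orthonormal_iff_ite.1 hu) k l
    rw [eucl_sum_single (u k), eucl_sum_single (u l)] at this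
    simp only [map_sum, map_smul, sum_inner, inner_sum, real_inner_smul_left,
      real_inner_smul_right] at this
    rw [Matrix.one_apply, ← this]
    simp only [Matrix.mul_apply, Finset.mul_sum]
    rw [Finset.sum_comm]
    refine Finset.sum_congr rfl fun i _ => Finset.sum_congr rfl fun j _ => ?_
    simp [hU, coordGram, partialD]
    ring
  have h2 : coordGram X y * (U * U.transpose) = 1 := by
    have := mul_eq_one_comm.1 h1
    rwa [mul_assoc] at this
  rw [Matrix.inv_eq_right_inv h2]
  have h3 : ∀ k, B (u k) (u k) = ∑ i, ∑ j, u k i * (u k j * B (EuclideanSpace.single i 1)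
      (EuclideanSpace.single j 1)) := by
    intro k
    conv_lhs => rw [eucl_sum_single (u k)]
    simp [Finset.mul_sum]
    rw [Finset.sum_comm]
    refine Finset.sum_congr rfl fun i _ => Finset.sum_congr rfl fun j _ => ?_
    ring
  simp only [h3, Matrix.mul_apply, Finset.sum_mul]
  rw [Finset.sum_comm_cycle]
  refine Finset.sum_congr rfl fun i _ => ?_
  refine Finset.sum_congr rfl fun j _ => ?_
  refine Finset.sum_congr rfl fun k _ => ?_
  simp [hU]
  ring

lemma inner_chartLap_fderiv {X : Eucl 3 → Eucl 4} {y : Eucl 3} (h : ContDiffAt ℝ ∞ X y)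
    (hinj : Function.Injective (fderiv ℝ X y)) (v : Eucl 3) :
    inner ℝ (chartLap X y) (fderiv ℝ X y v) = 0 := by
  rw [eucl_sum_single v]
  simp only [map_sum, map_smul, inner_sum, inner_smul_right]
  exact Finset.sum_eq_zero fun i _ => by
    rw [show inner ℝ (chartLap X y) (fderiv ℝ X y (EuclideanSpace.single i 1)) = 0 from
      inner_chartLap_tangent h hinj i, mul_zero]

lemma inner_chartLap_normal {X : Eucl 3 → Eucl 4} {y : Eucl 3} (h : ContDiffAt ℝ ∞ X y)
    (hinj : Function.Injective (fderiv ℝ X y)) {ν : Eucl 4}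
    (hν : ∀ u, inner ℝ (fderiv ℝ X y u) ν = 0)
    {u : Fin 3 → Eucl 3} (hu : Orthonormal ℝ fun k => fderiv ℝ X y (u k)) :
    inner ℝ (chartLap X y) ν =
      -∑ k, inner ℝ (fderiv ℝ (fderiv ℝ X) y (u k) (u k)) ν := by
  rw [inner_chartLap_normal_coord h hinj hν]
  have := sum_inv_coordGram hu (LinearMap.mk₂ ℝ
    (fun v w => inner ℝ (fderiv ℝ (fderiv ℝ X) y v w) ν)
    (by intros; simp [inner_add_left]) (by intros; simp [inner_smul_left])
    (by intros; simp [inner_add_left]) (by intros; simp [inner_smul_left]))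
  simp only [LinearMap.mk₂_apply] at this
  rw [this]

/-- An injective linear map out of a Euclidean space admits a family whose image is orthonormal. -/
lemma exists_orthonormal_comp {T : Eucl 3 →L[ℝ] Eucl 4} (hT : Function.Injective T) :
    ∃ u : Fin 3 → Eucl 3, Orthonormal ℝ fun k => T (u k) := by
  have hfr : Module.finrank ℝ (LinearMap.range T.toLinearMap) = 3 := by
    rw [LinearMap.finrank_range_of_inj hT]
    simp
  let b := (stdOrthonormalBasis ℝ (LinearMap.range T.toLinearMap)).reindex (finCongr hfr)
  choose u hu using fun k => (b k).2
  refine ⟨u, ?_⟩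
  have : (fun k => T (u k)) = fun k => ((b k : LinearMap.range T.toLinearMap) : Eucl 4) :=
    funext hu
  rw [this]
  exact b.orthonormal.comp_linearIsometry (Submodule.subtypeₗᵢ _)

/-- The Laplacian of a parametrization does not depend on the coordinates. -/
lemma chartLap_comp {X Y : Eucl 3 → Eucl 4} {ψ : Eucl 3 → Eucl 3} {y : Eucl 3}
    (hX : ContDiffAt ℝ ∞ X y) (hXinj : Function.Injective (fderiv ℝ X y))
    (hY : ContDiffAt ℝ ∞ Y (ψ y)) (hYinj : Function.Injective (fderiv ℝ Y (ψ y)))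
    (hψ : ContDiffAt ℝ ∞ ψ y) (hXY : X =ᶠ[nhds y] Y ∘ ψ) :
    chartLap X y = chartLap Y (ψ y) := by
  have hψd : ∀ᶠ z in nhds y, DifferentiableAt ℝ ψ z :=
    ((hψ.of_le (m := 1) (by simp)).eventually (by simp)).mono fun z hz => hz.differentiableAt (by simp)
  have hYd : ∀ᶠ z in nhds y, DifferentiableAt ℝ Y (ψ z) :=
    hψ.continuousAt.eventually
      (((hY.of_le (m := 1) (by simp)).eventually (by simp)).mono fun z hz => hz.differentiableAt (by simp))
  have hD : fderiv ℝ X =ᶠ[nhds y] fun z => (fderiv ℝ Y (ψ z)).comp (fderiv ℝ ψ z) := by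
    filter_upwards [hψd, hYd, hXY.eventuallyEq_nhds] with z h1 h2 h3
    rw [h3.fderiv_eq, fderiv_comp z h2 h1]
  have hDy : ∀ u, fderiv ℝ X y u = fderiv ℝ Y (ψ y) (fderiv ℝ ψ y u) := fun u => by
    rw [hD.eq_of_nhds]; rfl
  have hψinj : Function.Injective (fderiv ℝ ψ y) := by
    intro a b hab
    apply hXinj
    rw [hDy, hDy, hab]
  have hψsurj : Function.Surjective (fderiv ℝ ψ y) :=
    (LinearMap.injective_iff_surjective (f := (fderiv ℝ ψ y).toLinearMap)).1 hψinj
  -- The correction term in the chain rule for second derivatives is tangential, so normal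
  -- components transform as a tensor.
  have hD2 : ∀ u v, fderiv ℝ (fderiv ℝ X) y u v =
      fderiv ℝ (fderiv ℝ Y) (ψ y) (fderiv ℝ ψ y u) (fderiv ℝ ψ y v) +
      fderiv ℝ Y (ψ y) (fderiv ℝ (fderiv ℝ ψ) y u v) := by
    intro u v
    have h1 : HasFDerivAt (fderiv ℝ ψ) (fderiv ℝ (fderiv ℝ ψ) y) y :=
      ((hψ.fderiv_right (m := ∞) (by simp)).differentiableAt (by simp)).hasFDerivAt
    have h2 : HasFDerivAt (fderiv ℝ Y) (fderiv ℝ (fderiv ℝ Y) (ψ y)) (ψ y) :=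
      ((hY.fderiv_right (m := ∞) (by simp)).differentiableAt (by simp)).hasFDerivAt
    have h3 := (h2.comp y (hψ.differentiableAt (by simp)).hasFDerivAt).clm_comp h1
    rw [hD.fderiv_eq]
    erw [h3.fderiv]
    simp only [add_apply, ContinuousLinearMap.comp_apply]
    rw [add_comm]
    rfl
  -- Both Laplacians are normal to the same hyperplane, so their difference is itself a normal
  -- vector, and pairing the difference with itself suffices.
  have hν : ∀ u, inner ℝ (fderiv ℝ X y u) (chartLap X y - chartLap Y (ψ y)) = 0 := by
    intro u
    rw [inner_sub_right, real_inner_comm, inner_chartLap_fderiv hX hXinj, hDy,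
      real_inner_comm, inner_chartLap_fderiv hY hYinj, sub_zero]
  have hν' : ∀ u, inner ℝ (fderiv ℝ Y (ψ y) u) (chartLap X y - chartLap Y (ψ y)) = 0 := by
    intro u
    obtain ⟨v, rfl⟩ := hψsurj u
    rw [← hDy, hν]
  obtain ⟨u, hu⟩ := exists_orthonormal_comp hXinj
  have hu' : Orthonormal ℝ fun k => fderiv ℝ Y (ψ y) (fderiv ℝ ψ y (u k)) := by
    simpa only [hDy] using hu
  have key : inner ℝ (chartLap X y - chartLap Y (ψ y)) (chartLap X y - chartLap Y (ψ y)) = 0 := by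
    conv_lhs => rw [inner_sub_left]
    rw [inner_chartLap_normal hX hXinj hν hu, inner_chartLap_normal hY hYinj hν' hu']
    simp only [hD2, inner_add_left, hν']
    simp
  exact sub_eq_zero.1 (inner_self_eq_zero.1 key)

end ChartLaplacian

/-! ### Linear algebra at a point: forms with equal minors, adapted frames, degenerate shape
operators. -/

section PointwiseAlgebra

/-- Two `3 × 3` matrices with the same `2 × 2` minors, one of them invertible, agree up to sign. -/
lemma eq_or_eq_neg_of_minors {A B : Matrix (Fin 3) (Fin 3) ℝ} (hA : A.det ≠ 0)
    (h : ∀ i j k l, A i j * A k l - A i l * A k j = B i j * B k l - B i l * B k j) :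
    B = A ∨ B = -A := by
  have hadj : A.adjugate = B.adjugate := by
    rw [Matrix.adjugate_fin_three, Matrix.adjugate_fin_three]
    congr! 1
    ext i j
    have h1 := h 1 1 2 2
    have h2 := h 0 1 2 2
    have h3 := h 0 1 1 2
    have h4 := h 1 0 2 2
    have h5 := h 0 0 2 2
    have h6 := h 0 0 1 2
    have h7 := h 1 0 2 1
    have h8 := h 0 0 2 1
    have h9 := h 0 0 1 1
    fin_cases i <;> fin_cases j <;> simp <;> linarith
  have hdet : A.det ^ 2 = B.det ^ 2 := by
    have := congrArg Matrix.det hadj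
    rwa [Matrix.det_adjugate, Matrix.det_adjugate] at this
  -- Equal adjugates make A and B proportional; `hdet` says that the determinants agree up to sign.
  have hmul : A.det • B = B.det • A := by
    calc A.det • B = B * (A.adjugate * A) := by rw [Matrix.adjugate_mul]; simp
      _ = (B * B.adjugate) * A := by rw [hadj, mul_assoc]
      _ = B.det • A := by rw [Matrix.mul_adjugate]; simp
  rcases sq_eq_sq_iff_eq_or_eq_neg.1 hdet with h1 | h1
  · left
    rw [h1] at hmul
    exact smul_right_injective _ (h1 ▸ hA) hmul
  · right
    have h2 : B.det = -A.det := by linarith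
    rw [h2, neg_smul, ← smul_neg] at hmul
    exact smul_right_injective _ hA hmul

/-- The matrix of a bilinear form in the standard basis. -/
def bilinMatrix (b : Eucl 3 →ₗ[ℝ] Eucl 3 →ₗ[ℝ] ℝ) : Matrix (Fin 3) (Fin 3) ℝ :=
  Matrix.of fun i j => b (EuclideanSpace.single i 1) (EuclideanSpace.single j 1)

lemma bilin_ext {b c : Eucl 3 →ₗ[ℝ] Eucl 3 →ₗ[ℝ] ℝ} (h : bilinMatrix b = bilinMatrix c) :
    b = c := by
  refine LinearMap.ext₂ fun u v => ?_
  rw [eucl_sum_single u, eucl_sum_single v]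
  have h' : ∀ i j, b (EuclideanSpace.single i 1) (EuclideanSpace.single j 1) =
      c (EuclideanSpace.single i 1) (EuclideanSpace.single j 1) := fun i j =>
    congrFun (congrFun h i) j
  simp [h']

lemma bilinMatrix_det_ne_zero_iff {b : Eucl 3 →ₗ[ℝ] Eucl 3 →ₗ[ℝ] ℝ} :
    (bilinMatrix b).det ≠ 0 ↔ ∀ u, (∀ v, b u v = 0) → u = 0 := by
  have key : ∀ u : Eucl 3, (∀ v, b u v = 0) ↔ Matrix.vecMul u (bilinMatrix b) = 0 := by
    intro u
    have h1 : ∀ j, Matrix.vecMul u (bilinMatrix b) j = b u (EuclideanSpace.single j 1) := by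
      intro j
      conv_rhs => rw [eucl_sum_single u]
      simp [Matrix.vecMul, dotProduct, bilinMatrix]
    constructor
    · intro h
      ext j
      rw [h1, h]
      rfl
    · intro h v
      rw [eucl_sum_single v]
      simp [← h1, h]
  constructor
  · intro hdet u hu
    by_contra hne
    exact hdet (Matrix.exists_vecMul_eq_zero_iff.1
      ⟨u, fun h => hne (by ext i; exact congrFun h i), (key u).1 hu⟩)
  · intro h hdet
    obtain ⟨v, hv, hv0⟩ := Matrix.exists_vecMul_eq_zero_iff.2 hdet
    apply hv
    have := h (WithLp.toLp 2 v) ((key _).2 hv0)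
    ext i
    exact congrArg (fun w : Eucl 3 => w i) this

/-- A vector orthogonal to a hyperplane with normal `N` is a multiple of `N`. -/
lemma eq_smul_of_orthogonal {T : Eucl 3 →L[ℝ] Eucl 4} (hT : Function.Injective T)
    {N w : Eucl 4} (hN : N ≠ 0) (hTN : ∀ u, inner ℝ (T u) N = 0)
    (hw : ∀ u, inner ℝ (T u) w = 0) : w = (inner ℝ w N / inner ℝ N N) • N := by
  have hNN : inner ℝ N N ≠ 0 := inner_self_ne_zero.2 hN
  set S := LinearMap.range T.toLinearMap
  have hfr : Module.finrank ℝ Sᗮ = 1 := by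
    have h1 := S.finrank_add_finrank_orthogonal
    have h2 : Module.finrank ℝ S = 3 := by
      rw [LinearMap.finrank_range_of_inj hT]
      simp
    rw [h2] at h1
    simp at h1
    omega
  have hmem : ∀ z : Eucl 4, (∀ u, inner ℝ (T u) z = 0) → z ∈ Sᗮ := by
    intro z hz
    rw [Submodule.mem_orthogonal]
    rintro _ ⟨u, rfl⟩
    exact hz u
  obtain ⟨c, hc⟩ := (finrank_eq_one_iff_of_nonzero' (⟨N, hmem N hTN⟩ : Sᗮ)
    (fun h => hN (congrArg Subtype.val h))).1 hfr ⟨w, hmem w hw⟩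
  have hc' : c • N = w := congrArg Subtype.val hc
  rw [← hc', real_inner_smul_left, mul_div_cancel_right₀ _ hNN]

lemma eq_zero_of_orthogonal {T : Eucl 3 →L[ℝ] Eucl 4} (hT : Function.Injective T)
    {N w : Eucl 4} (hN : N ≠ 0) (hTN : ∀ u, inner ℝ (T u) N = 0)
    (hw : ∀ u, inner ℝ (T u) w = 0) (hwN : inner ℝ w N = 0) : w = 0 := by
  rw [eq_smul_of_orthogonal hT hN hTN hw, hwN]
  simp

/-- An orthonormal tangent frame together with the normal spans the ambient space. -/
lemma exists_orthonormalBasis_adapted {v : Fin 3 → Eucl 4} (hv : Orthonormal ℝ v) {N : Eucl 4}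
    (hN : N ≠ 0) (hvN : ∀ k, inner ℝ (v k) N = 0) :
    ∃ b : OrthonormalBasis (Fin 4) ℝ (Eucl 4), (∀ k : Fin 3, b k.succ = v k) ∧
      b 0 = (‖N‖⁻¹ : ℝ) • N := by
  have hN0 : ‖N‖ ≠ 0 := norm_ne_zero_iff.2 hN
  have ho : Orthonormal ℝ (Fin.cons ((‖N‖⁻¹ : ℝ) • N) v : Fin 4 → Eucl 4) := by
    rw [orthonormal_iff_ite]
    intro i j
    have hv' := orthonormal_iff_ite.1 hv
    refine Fin.cases ?_ (fun i => ?_) i <;> refine Fin.cases ?_ (fun j => ?_) j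
    · rw [Fin.cons_zero, if_pos rfl, real_inner_smul_left, real_inner_smul_right,
        real_inner_self_eq_norm_sq]
      field_simp
    · rw [Fin.cons_zero, Fin.cons_succ, if_neg (Fin.succ_ne_zero j).symm, real_inner_smul_left,
        real_inner_comm, hvN, mul_zero]
    · simp [real_inner_smul_right, hvN]
    · simp [hv']
  have hcard : Fintype.card (Fin 4) = Module.finrank ℝ (Eucl 4) := by simp
  let b := basisOfOrthonormalOfCardEqFinrank ho hcard
  have hbc : ⇑b = Fin.cons ((‖N‖⁻¹ : ℝ) • N) v := coe_basisOfOrthonormalOfCardEqFinrank ho hcard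
  refine ⟨b.toOrthonormalBasis (by rw [hbc]; exact ho), fun k => ?_, ?_⟩
  · rw [Module.Basis.coe_toOrthonormalBasis, hbc, Fin.cons_succ]
  · rw [Module.Basis.coe_toOrthonormalBasis, hbc, Fin.cons_zero]

lemma inner_eq_sum_adapted {v : Fin 3 → Eucl 4} (hv : Orthonormal ℝ v) {N : Eucl 4}
    (hN : N ≠ 0) (hvN : ∀ k, inner ℝ (v k) N = 0) (x y : Eucl 4) :
    inner ℝ x y = ∑ k, inner ℝ x (v k) * inner ℝ (v k) y +
      inner ℝ x N * inner ℝ N y / inner ℝ N N := by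
  obtain ⟨b, hb, hb0⟩ := exists_orthonormalBasis_adapted hv hN hvN
  have hN0 : ‖N‖ ≠ 0 := norm_ne_zero_iff.2 hN
  rw [← b.sum_inner_mul_inner x y, Fin.sum_univ_succ, hb0]
  simp only [hb]
  rw [real_inner_smul_left, real_inner_smul_right, real_inner_self_eq_norm_sq]
  field_simp
  ring

lemma trace_eq_sum_adapted {v : Fin 3 → Eucl 4} (hv : Orthonormal ℝ v) {N : Eucl 4}
    (hN : N ≠ 0) (hvN : ∀ k, inner ℝ (v k) N = 0) (T : Eucl 4 →ₗ[ℝ] Eucl 4) :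
    LinearMap.trace ℝ _ T = ∑ k, inner ℝ (v k) (T (v k)) + inner ℝ N (T N) / inner ℝ N N := by
  obtain ⟨b, hb, hb0⟩ := exists_orthonormalBasis_adapted hv hN hvN
  have hN0 : ‖N‖ ≠ 0 := norm_ne_zero_iff.2 hN
  rw [LinearMap.trace_eq_sum_inner T b, Fin.sum_univ_succ, hb0]
  simp only [hb, map_smul]
  rw [real_inner_smul_left, real_inner_smul_right, real_inner_self_eq_norm_sq]
  field_simp
  ring

lemma exists_decomp {T : Eucl 3 →L[ℝ] Eucl 4} (hT : Function.Injective T)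
    {N : Eucl 4} (hN : N ≠ 0) (hTN : ∀ u, inner ℝ (T u) N = 0) (a : Eucl 4) :
    ∃ γ, a = T γ + (inner ℝ a N / inner ℝ N N) • N := by
  obtain ⟨e, he⟩ := exists_orthonormal_comp hT
  refine ⟨∑ k, inner ℝ a (T (e k)) • e k, ext_inner_right ℝ fun b => ?_⟩
  rw [inner_eq_sum_adapted he hN (fun k => hTN _)]
  simp only [map_sum, map_smul, inner_add_left, sum_inner, real_inner_smul_left]
  ring

/-- Linear maps with the same Gram form differ by an isometry of the ambient space. -/
lemma exists_isometry_comp {X Y : Eucl 3 →L[ℝ] Eucl 4} (hX : Function.Injective X)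
    (h : ∀ u v, inner ℝ (Y u) (Y v) = inner ℝ (X u) (X v)) :
    ∃ P : Eucl 4 ≃ₗᵢ[ℝ] Eucl 4, ∀ u, P (X u) = Y u := by
  let e := LinearEquiv.ofInjective X.toLinearMap hX
  have he : ∀ u, ((e u : LinearMap.range X.toLinearMap) : Eucl 4) = X u := fun u => rfl
  let L : LinearMap.range X.toLinearMap →ₗᵢ[ℝ] Eucl 4 :=
    { toLinearMap := Y.toLinearMap ∘ₗ e.symm.toLinearMap
      norm_map' := by
        intro z
        obtain ⟨u, rfl⟩ := e.surjective z
        have h1 := h u u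
        rw [real_inner_self_eq_norm_sq, real_inner_self_eq_norm_sq] at h1
        have h2 : ‖Y u‖ = ‖X u‖ := by
          rwa [sq_eq_sq₀ (norm_nonneg _) (norm_nonneg _)] at h1
        change ‖Y (e.symm (e u))‖ = ‖X u‖
        rw [e.symm_apply_apply, h2] }
  refine ⟨L.extend.toLinearIsometryEquiv rfl, fun u => ?_⟩
  have h3 := L.extend_apply (e u)
  rw [he] at h3
  rw [LinearIsometry.coe_toLinearIsometryEquiv, h3]
  simp [L]

/-- Pointwise rigidity: first and second order data of two hypersurfaces with the same metric,
Christoffel symbols and curvature agree up to an isometry, if the second fundamental form of the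
first one is nondegenerate. -/
lemma exists_isometry_of_gauss {X Y : Eucl 3 →L[ℝ] Eucl 4}
    {X2 Y2 : Eucl 3 →L[ℝ] Eucl 3 →L[ℝ] Eucl 4} {N : Eucl 4} (hX : Function.Injective X)
    (hN : N ≠ 0) (hXN : ∀ u, inner ℝ (X u) N = 0)
    (hgram : ∀ u v, inner ℝ (Y u) (Y v) = inner ℝ (X u) (X v))
    (hkoszul : ∀ u v w, inner ℝ (Y2 u v) (Y w) = inner ℝ (X2 u v) (X w))
    (hgauss : ∀ u v w z, inner ℝ (Y2 u v) (Y2 w z) - inner ℝ (Y2 u z) (Y2 w v) =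
      inner ℝ (X2 u v) (X2 w z) - inner ℝ (X2 u z) (X2 w v))
    (hdet : ∀ u, (∀ v, inner ℝ (X2 u v) N = 0) → u = 0) :
    ∃ P : Eucl 4 ≃ₗᵢ[ℝ] Eucl 4, (∀ u, P (X u) = Y u) ∧ ∀ u v, P (X2 u v) = Y2 u v := by
  obtain ⟨P, hP⟩ := exists_isometry_comp hX hgram
  have hNN : inner ℝ N N ≠ 0 := inner_self_ne_zero.2 hN
  let b : Eucl 3 →ₗ[ℝ] Eucl 3 →ₗ[ℝ] ℝ := LinearMap.mk₂ ℝ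
    (fun v w => inner ℝ (X2 v w) N)
    (by intros; simp [inner_add_left]) (by intros; simp [inner_smul_left])
    (by intros; simp [inner_add_left]) (by intros; simp [inner_smul_left])
  let c : Eucl 3 →ₗ[ℝ] Eucl 3 →ₗ[ℝ] ℝ := LinearMap.mk₂ ℝ
    (fun v w => inner ℝ (P.symm (Y2 v w)) N)
    (by intros; simp [inner_add_left]) (by intros; simp [inner_smul_left])
    (by intros; simp [inner_add_left]) (by intros; simp [inner_smul_left])
  have hb : ∀ u v, b u v = inner ℝ (X2 u v) N := fun u v => rfl
  have hc : ∀ u v, c u v = inner ℝ (P.symm (Y2 u v)) N := fun u v => rfl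
  -- After transport by P, equal Christoffel symbols force the second derivatives to differ only
  -- along N.
  have hdiff : ∀ u v, X2 u v =
      P.symm (Y2 u v) + ((b u v - c u v) / inner ℝ N N) • N := by
    intro u v
    rw [hb, hc, ← inner_sub_left, ← eq_smul_of_orthogonal hX hN hXN, add_sub_cancel]
    intro w
    rw [inner_sub_right, real_inner_comm, ← hkoszul, ← hP w, real_inner_comm (P (X w)),
      ← P.inner_map_map (X w) (P.symm _)]
    simp
  have hminor : ∀ u v w z, b u v * b w z - b u z * b w v = c u v * c w z - c u z * c w v := by
    intro u v w z
    have h1 : ∀ u v w z, inner ℝ (X2 u v) (X2 w z) = inner ℝ (Y2 u v) (Y2 w z) +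
        (b u v * b w z - c u v * c w z) / inner ℝ N N := by
      intro u v w z
      rw [hdiff u v, hdiff w z]
      simp only [inner_add_left, inner_add_right, real_inner_smul_left, real_inner_smul_right,
        LinearIsometryEquiv.inner_map_map]
      rw [real_inner_comm (P.symm _) N, ← hc, ← hc]
      field_simp
      ring
    have h2 := hgauss u v w z
    rw [h1 u v, h1 u z] at h2
    have h3 : ((b u v * b w z - c u v * c w z) - (b u z * b w v - c u z * c w v)) /
      inner ℝ N N = 0 := by rw [sub_div]; linarith
    rw [div_eq_zero_iff, or_iff_left hNN] at h3
    linarith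
  have hcases := eq_or_eq_neg_of_minors (A := bilinMatrix b) (B := bilinMatrix c)
    (bilinMatrix_det_ne_zero_iff.2 hdet) fun i j k l => hminor _ _ _ _
  rcases hcases with h | h
  · have hcb := bilin_ext h
    refine ⟨P, hP, fun u v => ?_⟩
    have := hdiff u v
    rw [hcb, sub_self, zero_div, zero_smul, add_zero] at this
    rw [this, P.apply_symm_apply]
  · have hcb : c = -b := by
      apply bilin_ext
      rw [h]
      ext i j
      simp [bilinMatrix]
    -- P is determined on the tangent space only; the reflection in that hyperplane absorbs the
    -- wrong sign of the second form.
    let R := (ℝ ∙ N)ᗮ.reflection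
    have hRN : R N = -N :=
      Submodule.reflection_mem_subspace_orthogonal_precomplement_eq_neg
        (Submodule.mem_span_singleton_self N)
    have hRX : ∀ u, R (X u) = X u := fun u =>
      Submodule.reflection_mem_subspace_eq_self
        (Submodule.mem_orthogonal_singleton_iff_inner_left.2 (hXN u))
    refine ⟨R.trans P, fun u => ?_, fun u v => ?_⟩
    · simp [hRX, hP]
    · have h1 := hdiff u v
      have h2 : R (X2 u v) = X2 u v - (2 * b u v / inner ℝ N N) • N := by
        have h3 : X2 u v - (b u v / inner ℝ N N) • N ∈ (ℝ ∙ N)ᗮ := by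
          rw [Submodule.mem_orthogonal_singleton_iff_inner_left, inner_sub_left,
            real_inner_smul_left, hb, div_mul_cancel₀ _ hNN, sub_self]
        have h4 := Submodule.reflection_mem_subspace_eq_self h3
        change R _ = _ at h4
        rw [map_sub, map_smul, hRN] at h4
        rw [sub_eq_iff_eq_add.1 h4]
        module
      have h5 : P.symm (Y2 u v) = R (X2 u v) := by
        rw [h2, h1]
        simp only [hcb, LinearMap.neg_apply]
        module
      rw [LinearIsometryEquiv.trans_apply, ← h5, P.apply_symm_apply]

/-- Trace of a singular `3 × 3` matrix `S` with `S² = c² - A`, `A S = 0` and `tr A = c²`. -/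
lemma trace_of_singular {S A : Matrix (Fin 3) (Fin 3) ℝ} {c : ℝ} (hc : 0 < c)
    (hS : S * S = (c ^ 2) • (1 : Matrix (Fin 3) (Fin 3) ℝ) - A) (hA : A * S = 0)
    (hAtr : A.trace = c ^ 2) (hdet : S.det = 0) (htr : 0 < S.trace) : S.trace = 2 * c := by
  -- Newton's identity for power sums. With tr S² = 2c² and tr S³ = c² tr S it becomes (tr S)³ = 4c²
  -- tr S.
  have h1 : (S * S * S).trace = S.trace ^ 3 - 3 * S.trace * ((S.trace ^ 2 - (S * S).trace) / 2)
      + 3 * S.det := by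
    simp only [Matrix.trace, Fin.sum_univ_three, Matrix.det_fin_three, Matrix.diag,
      Matrix.mul_apply]
    ring
  have h2 : (S * S).trace = 2 * c ^ 2 := by
    rw [hS, Matrix.trace_sub, Matrix.trace_smul, hAtr, Matrix.trace_one]
    simp
    ring
  have h3 : (S * S * S).trace = c ^ 2 * S.trace := by
    rw [hS, sub_mul, hA, smul_mul_assoc, one_mul, sub_zero, Matrix.trace_smul, smul_eq_mul]
  rw [h2, h3, hdet] at h1
  have h4 : S.trace * ((S.trace - 2 * c) * (S.trace + 2 * c)) = 0 := by linear_combination 2 * h1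
  rcases mul_eq_zero.1 h4 with h | h
  · exact absurd h htr.ne'
  · rcases mul_eq_zero.1 h with h | h <;> nlinarith

/-- Where the second fundamental form is degenerate, the mean curvature is determined. -/
lemma trace_of_degenerate {X L : Eucl 3 →L[ℝ] Eucl 4} {N : Eucl 4} {c : ℝ} (hc : 0 < c)
    (hX : Function.Injective X) (hN : N ≠ 0) (hXN : ∀ u, inner ℝ (X u) N = 0)
    (hsymm : ∀ u v, inner ℝ (X u) (L v) = inner ℝ (X v) (L u))
    (hhom : ∀ u v, inner ℝ (L u) (L v) = c ^ 2 * inner ℝ (X u) (X v))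
    {e : Fin 3 → Eucl 3} (he : Orthonormal ℝ fun k => X (e k))
    (htr : 0 < ∑ k, inner ℝ (X (e k)) (L (e k)))
    {u : Eucl 3} (hu : u ≠ 0) (hdeg : ∀ v, inner ℝ (X u) (L v) = 0) :
    ∑ k, inner ℝ (X (e k)) (L (e k)) = 2 * c := by
  have hNN : 0 < inner ℝ N N := real_inner_self_pos.2 hN
  have he' := orthonormal_iff_ite.1 he
  set S : Matrix (Fin 3) (Fin 3) ℝ := Matrix.of fun i j => inner ℝ (X (e i)) (L (e j)) with hS
  set A : Matrix (Fin 3) (Fin 3) ℝ := Matrix.of fun i j =>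
    inner ℝ (L (e i)) N * inner ℝ (L (e j)) N / inner ℝ N N with hA
  set t : Fin 3 → ℝ := fun k => inner ℝ (X u) (X (e k)) with ht
  -- S records the tangential part of L; the matrix A accounts for the normal part of ⟨L, L⟩.
  have hSS : S * S = (c ^ 2) • (1 : Matrix (Fin 3) (Fin 3) ℝ) - A := by
    ext i j
    have h1 := inner_eq_sum_adapted he hN (fun k => hXN _) (L (e i)) (L (e j))
    rw [hhom, he'] at h1
    simp only [Matrix.mul_apply, Matrix.sub_apply, Matrix.smul_apply, Matrix.one_apply, hS, hA,
      Matrix.of_apply, smul_eq_mul]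
    rw [h1, real_inner_comm (L (e j)) N]
    simp only [hsymm (e i), real_inner_comm (X (e _)) (L (e i))]
    ring
  have hT : ∀ w, inner ℝ (X u) w = ∑ k, t k * inner ℝ (X (e k)) w := by
    intro w
    rw [inner_eq_sum_adapted he hN (fun k => hXN _) (X u) w, hXN]
    simp [ht]
  have htS : Matrix.vecMul t S = 0 := by
    ext j
    simp only [Matrix.vecMul, dotProduct, hS, Matrix.of_apply, ← hT, hdeg]
    rfl
  have ht0 : t ≠ 0 := by
    intro h
    have h1 := hT (X u)
    rw [h] at h1
    simp at h1
    exact hu (hX (by rw [h1, map_zero]))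
  have hdet : S.det = 0 := Matrix.exists_vecMul_eq_zero_iff.1 ⟨t, ht0, htS⟩
  set a : Fin 3 → ℝ := fun k => inner ℝ (L (e k)) N with ha
  set s : ℝ := (∑ k, t k * a k) / inner ℝ N N with hs
  -- Applying t to S² = c² - A gives c²t = tA. Since A is built from a alone, t is a multiple of a,
  -- so a also annihilates S.
  have hta : ∀ j, c ^ 2 * t j = s * a j := by
    intro j
    have h1 : Matrix.vecMul t (S * S) = 0 := by
      rw [← Matrix.vecMul_vecMul, htS, Matrix.zero_vecMul]
    rw [hSS, Matrix.vecMul_sub, Matrix.vecMul_smul, Matrix.vecMul_one] at h1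
    have h2 := congrFun h1 j
    simp only [Pi.sub_apply, Pi.smul_apply, smul_eq_mul, Pi.zero_apply, Matrix.vecMul,
      dotProduct] at h2
    rw [sub_eq_zero] at h2
    rw [h2, hs, Finset.sum_div, Finset.sum_mul]
    refine Finset.sum_congr rfl fun k _ => ?_
    simp only [hA, ha, Matrix.of_apply]
    ring
  have hs0 : s ≠ 0 := by
    intro h
    apply ht0
    ext j
    have := hta j
    rw [h, zero_mul] at this
    simpa [hc.ne'] using this
  have haS : ∀ j, ∑ k, a k * S k j = 0 := by
    intro j
    have h1 : s * ∑ k, a k * S k j = 0 := by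
      have h2 : ∑ k, t k * S k j = 0 := congrFun htS j
      calc s * ∑ k, a k * S k j = c ^ 2 * ∑ k, t k * S k j := by
            simp only [Finset.mul_sum, ← mul_assoc, hta]
        _ = 0 := by rw [h2, mul_zero]
    exact (mul_eq_zero.1 h1).resolve_left hs0
  have hAS : A * S = 0 := by
    ext i j
    rw [Matrix.mul_apply]
    calc ∑ k, A i k * S k j = a i / inner ℝ N N * ∑ k, a k * S k j := by
          rw [Finset.mul_sum]
          refine Finset.sum_congr rfl fun k _ => ?_
          simp only [hA, ha, Matrix.of_apply]
          ring
      _ = _ := by rw [haS, mul_zero]; rfl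
  have hAtr : A.trace = c ^ 2 := by
    have h1 : s * A.trace = s * c ^ 2 := by
      have h2 : A.trace = (∑ k, a k * a k) / inner ℝ N N := by
        simp only [Matrix.trace, Matrix.diag, hA, Matrix.of_apply, Finset.sum_div, ha]
      rw [h2, mul_div_assoc', Finset.mul_sum]
      simp only [← mul_assoc, ← hta]
      simp only [mul_assoc, ← Finset.mul_sum]
      rw [mul_div_assoc, mul_comm, hs]
    exact mul_left_cancel₀ hs0 h1
  exact trace_of_singular hc hSS hAS hAtr hdet htr

end PointwiseAlgebra

/-! ### Christoffel symbols and curvature from the metric, then the local rigidity theorem. -/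

section LocalTheorem

open Filter Topology

lemma differentiableAt_fderiv {E F : Type*} [NormedAddCommGroup E] [NormedSpace ℝ E]
    [NormedAddCommGroup F] [NormedSpace ℝ F] {X : E → F} {y : E} (h : ContDiffAt ℝ ∞ X y) :
    DifferentiableAt ℝ (fderiv ℝ X) y :=
  (h.fderiv_right (m := ∞) (by simp)).differentiableAt (by simp)

lemma HasFDerivAt.clm_apply_const {E F G : Type*} [NormedAddCommGroup E] [NormedSpace ℝ E]
    [NormedAddCommGroup F] [NormedSpace ℝ F] [NormedAddCommGroup G] [NormedSpace ℝ G]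
    {A : E → F →L[ℝ] G} {A' : E →L[ℝ] F →L[ℝ] G} {y : E} (h : HasFDerivAt A A' y) (v : F) :
    HasFDerivAt (fun y => A y v) (A'.flip v) y := by
  convert h.clm_apply (hasFDerivAt_const v y) using 1
  ext w
  simp

lemma hasFDerivAt_fderiv_apply {E F : Type*} [NormedAddCommGroup E] [NormedSpace ℝ E]
    [NormedAddCommGroup F] [NormedSpace ℝ F] {X : E → F} {y : E} (h : ContDiffAt ℝ ∞ X y) (v : E) :
    HasFDerivAt (fun y => fderiv ℝ X y v) ((fderiv ℝ (fderiv ℝ X) y).flip v) y :=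
  (differentiableAt_fderiv h).hasFDerivAt.clm_apply_const v

/-- The derivative of an inner product of two functions that is locally equal to that of two
others. -/
lemma inner_deriv_congr {E F : Type*} [NormedAddCommGroup E] [NormedSpace ℝ E]
    [NormedAddCommGroup F] [InnerProductSpace ℝ F] {a b a' b' : E → F} {A B A' B' : E →L[ℝ] F}
    {y : E} (ha : HasFDerivAt a A y) (hb : HasFDerivAt b B y) (ha' : HasFDerivAt a' A' y)
    (hb' : HasFDerivAt b' B' y)
    (h : ∀ᶠ z in 𝓝 y, inner ℝ (a z) (b z) = inner ℝ (a' z) (b' z)) (w : E) :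
    inner ℝ (a y) (B w) + inner ℝ (A w) (b y) = inner ℝ (a' y) (B' w) + inner ℝ (A' w) (b' y) := by
  have h1 := ha.inner ℝ hb
  have h2 := ha'.inner ℝ hb'
  have h3 := congrArg (fun T : E →L[ℝ] ℝ => T w)
    (h1.unique (h2.congr_of_eventuallyEq h))
  simpa [fderivInnerCLM_apply] using h3

/-- The derivative of a locally constant inner product vanishes. -/
lemma inner_deriv_eq_zero {E F : Type*} [NormedAddCommGroup E] [NormedSpace ℝ E]
    [NormedAddCommGroup F] [InnerProductSpace ℝ F] {a b : E → F} {A B : E →L[ℝ] F}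
    {y : E} (ha : HasFDerivAt a A y) (hb : HasFDerivAt b B y) {k : ℝ}
    (h : ∀ᶠ z in 𝓝 y, inner ℝ (a z) (b z) = k) (w : E) :
    inner ℝ (a y) (B w) + inner ℝ (A w) (b y) = 0 := by
  have h3 := congrArg (fun T : E →L[ℝ] ℝ => T w)
    ((ha.inner ℝ hb).unique ((hasFDerivAt_const k y).congr_of_eventuallyEq h))
  simpa [fderivInnerCLM_apply] using h3

/-- Parametrizations with the same first fundamental form have the same Christoffel symbols. -/
lemma koszul_congr {U : Set (Eucl 3)} (hU : IsOpen U) {X Y : Eucl 3 → Eucl 4}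
    (hX : ∀ y ∈ U, ContDiffAt ℝ ∞ X y) (hY : ∀ y ∈ U, ContDiffAt ℝ ∞ Y y)
    (h : ∀ y ∈ U, ∀ u v, inner ℝ (fderiv ℝ Y y u) (fderiv ℝ Y y v) =
      inner ℝ (fderiv ℝ X y u) (fderiv ℝ X y v)) {y : Eucl 3} (hy : y ∈ U) (u v w : Eucl 3) :
    inner ℝ (fderiv ℝ (fderiv ℝ Y) y u v) (fderiv ℝ Y y w) =
      inner ℝ (fderiv ℝ (fderiv ℝ X) y u v) (fderiv ℝ X y w) := by
  -- Derivative of the metric identity; the Koszul combination of its cyclic permutations isolates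
  -- one second derivative.
  have key : ∀ u v w, inner ℝ (fderiv ℝ (fderiv ℝ Y) y w v) (fderiv ℝ Y y u) +
      inner ℝ (fderiv ℝ (fderiv ℝ Y) y w u) (fderiv ℝ Y y v) =
      inner ℝ (fderiv ℝ (fderiv ℝ X) y w v) (fderiv ℝ X y u) +
      inner ℝ (fderiv ℝ (fderiv ℝ X) y w u) (fderiv ℝ X y v) := by
    intro u v w
    have := inner_deriv_congr (hasFDerivAt_fderiv_apply (hY y hy) u)
      (hasFDerivAt_fderiv_apply (hY y hy) v) (hasFDerivAt_fderiv_apply (hX y hy) u)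
      (hasFDerivAt_fderiv_apply (hX y hy) v)
      (by filter_upwards [hU.mem_nhds hy] with z hz using h z hz u v) w
    simp only [ContinuousLinearMap.flip_apply] at this
    rwa [real_inner_comm, real_inner_comm (fderiv ℝ (fderiv ℝ X) y w v)] at this
  have sX := fderiv_fderiv_symm (hX y hy)
  have sY := fderiv_fderiv_symm (hY y hy)
  have k1 := key v w u
  have k2 := key u w v
  have k3 := key u v w
  rw [sX v u, sY v u] at k2
  rw [sX w v, sX w u, sY w v, sY w u] at k3
  linarith

/-- Parametrizations with the same first fundamental form have the same curvature. -/
lemma gauss_congr {U : Set (Eucl 3)} (hU : IsOpen U) {X Y : Eucl 3 → Eucl 4}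
    (hX : ∀ y ∈ U, ContDiffAt ℝ ∞ X y) (hY : ∀ y ∈ U, ContDiffAt ℝ ∞ Y y)
    (h : ∀ y ∈ U, ∀ u v, inner ℝ (fderiv ℝ Y y u) (fderiv ℝ Y y v) =
      inner ℝ (fderiv ℝ X y u) (fderiv ℝ X y v)) {y : Eucl 3} (hy : y ∈ U) (u v w z : Eucl 3) :
    inner ℝ (fderiv ℝ (fderiv ℝ Y) y u v) (fderiv ℝ (fderiv ℝ Y) y w z) -
      inner ℝ (fderiv ℝ (fderiv ℝ Y) y u z) (fderiv ℝ (fderiv ℝ Y) y w v) =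
    inner ℝ (fderiv ℝ (fderiv ℝ X) y u v) (fderiv ℝ (fderiv ℝ X) y w z) -
      inner ℝ (fderiv ℝ (fderiv ℝ X) y u z) (fderiv ℝ (fderiv ℝ X) y w v) := by
  have h2 : ∀ {X : Eucl 3 → Eucl 4}, (∀ y ∈ U, ContDiffAt ℝ ∞ X y) → ∀ u v,
      HasFDerivAt (fun y => fderiv ℝ (fderiv ℝ X) y u v)
        (((fderiv ℝ (fderiv ℝ (fderiv ℝ X)) y).flip u).flip v) y := by
    intro X hX u v
    exact (hasFDerivAt_fderiv_apply ((hX y hy).fderiv_right (m := ∞) (by simp))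
      u).clm_apply_const v
  have h3 : ∀ {X : Eucl 3 → Eucl 4}, (∀ y ∈ U, ContDiffAt ℝ ∞ X y) → ∀ u v w,
      fderiv ℝ (fderiv ℝ (fderiv ℝ X)) y u v w = fderiv ℝ (fderiv ℝ (fderiv ℝ X)) y v u w := by
    intro X hX u v w
    rw [fderiv_fderiv_symm ((hX y hy).fderiv_right (m := ∞) (by simp))]
  -- Derivative of the Koszul identity. Antisymmetrizing in two arguments cancels the third
  -- derivatives and leaves the Gauss equation.
  have key : ∀ u v w z,
      inner ℝ (fderiv ℝ (fderiv ℝ Y) y u v) (fderiv ℝ (fderiv ℝ Y) y z w) +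
      inner ℝ (fderiv ℝ (fderiv ℝ (fderiv ℝ Y)) y z u v) (fderiv ℝ Y y w) =
      inner ℝ (fderiv ℝ (fderiv ℝ X) y u v) (fderiv ℝ (fderiv ℝ X) y z w) +
      inner ℝ (fderiv ℝ (fderiv ℝ (fderiv ℝ X)) y z u v) (fderiv ℝ X y w) := by
    intro u v w z
    have := inner_deriv_congr (h2 hY u v) (hasFDerivAt_fderiv_apply (hY y hy) w) (h2 hX u v)
      (hasFDerivAt_fderiv_apply (hX y hy) w)
      (by filter_upwards [hU.mem_nhds hy] with z hz using koszul_congr hU hX hY h hz u v w) z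
    simpa only [ContinuousLinearMap.flip_apply] using this
  have sX := fderiv_fderiv_symm (hX y hy)
  have sY := fderiv_fderiv_symm (hY y hy)
  have k1 := key v u w z
  have k2 := key z u w v
  rw [h3 hX z, h3 hY z] at k1
  rw [sX u v, sX w z, sX u z, sX w v, sY u v, sY w z, sY u z, sY w v]
  linarith

/-- A parametrized hypersurface `x` and a normal field `z` inducing the same metric, with trace of
the mixed form proportional to the square of the length of `z`. -/
structure IsometricNormalPair (c : ℝ) (U : Set (Eucl 3)) (x z : Eucl 3 → Eucl 4) : Prop where
  pos : 0 < c
  isOpen : IsOpen U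
  smooth : ∀ y ∈ U, ContDiffAt ℝ ∞ x y
  smooth_normal : ∀ y ∈ U, ContDiffAt ℝ ∞ z y
  injective : ∀ y ∈ U, Function.Injective (fderiv ℝ x y)
  normal : ∀ y ∈ U, ∀ u, inner ℝ (fderiv ℝ x y u) (z y) = 0
  isometric : ∀ y ∈ U, ∀ u v, inner ℝ (fderiv ℝ z y u) (fderiv ℝ z y v) =
    inner ℝ (fderiv ℝ x y u) (fderiv ℝ x y v)
  trace : ∀ y ∈ U, ∀ e : Fin 3 → Eucl 3, (Orthonormal ℝ fun k => fderiv ℝ x y (e k)) →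
    ∑ k, inner ℝ (fderiv ℝ x y (e k)) (fderiv ℝ z y (e k)) = c * inner ℝ (z y) (z y)

/-! ### Isometric normal pairs: dz = dx. -/

namespace IsometricNormalPair

variable {c : ℝ} {U : Set (Eucl 3)} {x z : Eucl 3 → Eucl 4}

lemma mono (h : IsometricNormalPair c U x z) {V : Set (Eucl 3)} (hV : IsOpen V) (hVU : V ⊆ U) :
    IsometricNormalPair c V x z where
  pos := h.pos
  isOpen := hV
  smooth y hy := h.smooth y (hVU hy)
  smooth_normal y hy := h.smooth_normal y (hVU hy)
  injective y hy := h.injective y (hVU hy)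
  normal y hy := h.normal y (hVU hy)
  isometric y hy := h.isometric y (hVU hy)
  trace y hy := h.trace y (hVU hy)

lemma hasFDerivAt_normal (h : IsometricNormalPair c U x z) {y : Eucl 3} (hy : y ∈ U) :
    HasFDerivAt z (fderiv ℝ z y) y :=
  ((h.smooth_normal y hy).differentiableAt (by simp)).hasFDerivAt

lemma inner_second (h : IsometricNormalPair c U x z) {y : Eucl 3} (hy : y ∈ U) (u v : Eucl 3) :
    inner ℝ (fderiv ℝ (fderiv ℝ x) y u v) (z y) =
      -inner ℝ (fderiv ℝ x y v) (fderiv ℝ z y u) := by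
  have := inner_deriv_eq_zero (hasFDerivAt_fderiv_apply (h.smooth y hy) v)
    (h.hasFDerivAt_normal hy) (k := 0)
    (by filter_upwards [h.isOpen.mem_nhds hy] with w hw using h.normal w hw v) u
  simp only [ContinuousLinearMap.flip_apply] at this
  linarith

lemma symm (h : IsometricNormalPair c U x z) {y : Eucl 3} (hy : y ∈ U) (u v : Eucl 3) :
    inner ℝ (fderiv ℝ x y u) (fderiv ℝ z y v) = inner ℝ (fderiv ℝ x y v) (fderiv ℝ z y u) := by
  have h1 := h.inner_second hy u v
  have h2 := h.inner_second hy v u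
  rw [fderiv_fderiv_symm (h.smooth y hy)] at h1
  linarith

lemma injective_normal (h : IsometricNormalPair c U x z) {y : Eucl 3} (hy : y ∈ U) :
    Function.Injective (fderiv ℝ z y) := by
  intro a b hab
  apply h.injective y hy
  rw [← sub_eq_zero, ← map_sub, ← inner_self_eq_zero (𝕜 := ℝ), ← h.isometric y hy, map_sub, hab,
    sub_self, inner_zero_left]

/-- A zero of z would make the images of dx and dz orthogonal, but two 3-dimensional subspaces of a
4-dimensional space cannot be. -/
lemma ne_zero (h : IsometricNormalPair c U x z) {y : Eucl 3} (hy : y ∈ U) : z y ≠ 0 := by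
  intro h0
  have h1 : ∀ u v, inner ℝ (fderiv ℝ x y u) (fderiv ℝ z y v) = 0 := by
    intro u v
    have := h.inner_second hy v u
    rw [h0, inner_zero_right] at this
    linarith
  have h2 : LinearMap.range (fderiv ℝ z y).toLinearMap ≤
      (LinearMap.range (fderiv ℝ x y).toLinearMap)ᗮ := by
    rintro _ ⟨v, rfl⟩
    rw [Submodule.mem_orthogonal]
    rintro _ ⟨u, rfl⟩
    exact h1 u v
  have h3 := Submodule.finrank_mono h2
  have h4 := (LinearMap.range (fderiv ℝ x y).toLinearMap).finrank_add_finrank_orthogonal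
  rw [LinearMap.finrank_range_of_inj (h.injective_normal hy)] at h3
  rw [LinearMap.finrank_range_of_inj (h.injective y hy)] at h4
  simp at h3 h4
  omega

/-- Nondegeneracy of the second fundamental form. -/
def Nondeg (x z : Eucl 3 → Eucl 4) (y : Eucl 3) : Prop :=
  ∀ u, (∀ v, inner ℝ (fderiv ℝ (fderiv ℝ x) y u v) (z y) = 0) → u = 0

lemma eventually_nondeg (h : IsometricNormalPair c U x z) {y : Eucl 3} (hy : y ∈ U)
    (hn : Nondeg x z y) : ∀ᶠ w in 𝓝 y, Nondeg x z w := by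
  let b : Eucl 3 → Eucl 3 →ₗ[ℝ] Eucl 3 →ₗ[ℝ] ℝ := fun y => LinearMap.mk₂ ℝ
    (fun v w => inner ℝ (fderiv ℝ (fderiv ℝ x) y v w) (z y))
    (by intros; simp [inner_add_left]) (by intros; simp [inner_smul_left])
    (by intros; simp [inner_add_left]) (by intros; simp [inner_smul_left])
  have hb : ∀ w, Nondeg x z w ↔ (bilinMatrix (b w)).det ≠ 0 := fun w =>
    (bilinMatrix_det_ne_zero_iff (b := b w)).symm
  have hc1 : ContinuousAt (fderiv ℝ (fderiv ℝ x)) y :=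
    (((h.smooth y hy).fderiv_right (m := ∞) (by simp)).fderiv_right
      (m := ∞) (by simp)).continuousAt
  have hc2 : ContinuousAt z y := (h.smooth_normal y hy).continuousAt
  have hcont : ContinuousAt (fun w => (bilinMatrix (b w)).det) y := by
    have : ∀ i j, ContinuousAt (fun w => bilinMatrix (b w) i j) y := fun i j =>
      ((hc1.clm_apply continuousAt_const).clm_apply continuousAt_const).inner hc2
    simp only [Matrix.det_fin_three]
    fun_prop
  simp only [hb] at hn ⊢
  exact hcont.eventually_ne hn

lemma exists_isometry (h : IsometricNormalPair c U x z) {y : Eucl 3} (hy : y ∈ U)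
    (hn : Nondeg x z y) :
    ∃ P : Eucl 4 ≃ₗᵢ[ℝ] Eucl 4, (∀ u, P (fderiv ℝ x y u) = fderiv ℝ z y u) ∧
      ∀ u v, P (fderiv ℝ (fderiv ℝ x) y u v) = fderiv ℝ (fderiv ℝ z) y u v :=
  exists_isometry_of_gauss (h.injective y hy) (h.ne_zero hy) (h.normal y hy) (h.isometric y hy)
    (koszul_congr h.isOpen h.smooth h.smooth_normal h.isometric hy)
    (gauss_congr h.isOpen h.smooth h.smooth_normal h.isometric hy) hn

/-- Rigidity: where the second fundamental form is nondegenerate, `dz = P ∘ dx` locally, for a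
fixed isometry `P`. -/
lemma exists_local_isometry (h : IsometricNormalPair c U x z) {y₀ : Eucl 3} (hy₀ : y₀ ∈ U)
    (hn : Nondeg x z y₀) :
    ∃ r > 0, ∃ P : Eucl 4 →L[ℝ] Eucl 4, Metric.ball y₀ r ⊆ U ∧
      (∀ a b, inner ℝ (P a) (P b) = inner ℝ a b) ∧
      (∀ y ∈ Metric.ball y₀ r, Nondeg x z y) ∧
      ∀ y ∈ Metric.ball y₀ r, ∀ u, fderiv ℝ z y u = P (fderiv ℝ x y u) := by
  obtain ⟨u₀, v₀, huv⟩ : ∃ u₀ v₀, inner ℝ (fderiv ℝ (fderiv ℝ x) y₀ u₀ v₀) (z y₀) ≠ 0 := by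
    by_contra! hcon
    have h1 := hn (EuclideanSpace.single 0 1) (hcon _)
    simpa using congrArg (fun v : Eucl 3 => v 0) h1
  have hc1 : ContinuousAt (fderiv ℝ (fderiv ℝ x)) y₀ :=
    (((h.smooth y₀ hy₀).fderiv_right (m := ∞) (by simp)).fderiv_right
      (m := ∞) (by simp)).continuousAt
  have hev : ∀ᶠ y in 𝓝 y₀, inner ℝ (fderiv ℝ (fderiv ℝ x) y u₀ v₀) (z y) ≠ 0 :=
    (((hc1.clm_apply continuousAt_const).clm_apply continuousAt_const).inner
      (h.smooth_normal y₀ hy₀).continuousAt).eventually_ne huv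
  obtain ⟨r, hr, hball⟩ := Metric.eventually_nhds_iff_ball.1
    (hev.and ((h.eventually_nondeg hy₀ hn).and (h.isOpen.mem_nhds hy₀)))
  have hB : ∀ y ∈ Metric.ball y₀ r, y ∈ U := fun y hy => (hball y hy).2.2
  -- The vector x₂(u₀, v₀), where x₂ is the second derivative of x, has a nonzero normal component,
  -- so with the tangent space it spans 𝔼⁴. This writes the pointwise isometry as `E z y` ∘ (`E x
  -- y`)⁻¹, which is visibly differentiable in y.
  let E : (Eucl 3 → Eucl 4) → Eucl 3 → (Eucl 3 × ℝ) →L[ℝ] Eucl 4 := fun f y =>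
    (fderiv ℝ f y).comp (ContinuousLinearMap.fst ℝ (Eucl 3) ℝ) +
      (ContinuousLinearMap.snd ℝ (Eucl 3) ℝ).smulRight (fderiv ℝ (fderiv ℝ f) y u₀ v₀)
  have hE : ∀ f y p, E f y p = fderiv ℝ f y p.1 + p.2 • fderiv ℝ (fderiv ℝ f) y u₀ v₀ :=
    fun f y p => rfl
  have hEd : ∀ f y, ContDiffAt ℝ ∞ f y → DifferentiableAt ℝ (E f) y := by
    intro f y hf
    have h1 := differentiableAt_fderiv hf
    have h2 := differentiableAt_fderiv (hf.fderiv_right (m := ∞) (by simp))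
    have h3 : DifferentiableAt ℝ (fun y => fderiv ℝ (fderiv ℝ f) y u₀ v₀) y :=
      (h2.clm_apply (differentiableAt_const _)).clm_apply (differentiableAt_const _)
    refine (h1.clm_comp (differentiableAt_const _)).add ?_
    exact (ContinuousLinearMap.smulRightL ℝ (Eucl 3 × ℝ) (Eucl 4)
      (ContinuousLinearMap.snd ℝ (Eucl 3) ℝ)).differentiableAt.comp y h3
  have hEinv : ∀ y ∈ Metric.ball y₀ r, ∃ e : (Eucl 3 × ℝ) ≃L[ℝ] Eucl 4, E x y = e := by
    intro y hy
    have hinj : Function.Injective (E x y) := by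
      rw [← ContinuousLinearMap.coe_coe, ← LinearMap.ker_eq_bot, LinearMap.ker_eq_bot']
      intro p hp
      have hp' : fderiv ℝ x y p.1 + p.2 • fderiv ℝ (fderiv ℝ x) y u₀ v₀ = 0 := hp
      have h1 := congrArg (fun a => inner ℝ a (z y)) hp'
      simp only [inner_add_left, h.normal y (hB y hy), real_inner_smul_left, inner_zero_left,
        zero_add] at h1
      have h2 : p.2 = 0 := (mul_eq_zero.1 h1).resolve_right (hball y hy).1
      rw [h2, zero_smul, add_zero] at hp'
      exact Prod.ext (h.injective y (hB y hy) (by rw [hp', Prod.fst_zero, map_zero])) h2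
    let e := (LinearEquiv.ofInjectiveOfFinrankEq (E x y).toLinearMap hinj
      (by simp)).toContinuousLinearEquiv
    exact ⟨e, ContinuousLinearMap.ext fun p => rfl⟩
  let P : Eucl 3 → Eucl 4 →L[ℝ] Eucl 4 := fun y => (E z y).comp (E x y).inverse
  have hPd : ∀ y ∈ Metric.ball y₀ r, DifferentiableAt ℝ P y := by
    intro y hy
    refine (hEd z y (h.smooth_normal y (hB y hy))).clm_comp ?_
    obtain ⟨e, he⟩ := hEinv y hy
    have h1 := (contDiffAt_map_inverse (𝕜 := ℝ) (n := 1) e).differentiableAt (by simp)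
    rw [← he] at h1
    exact h1.comp y (hEd x y (h.smooth y (hB y hy)))
  have hPiso : ∀ y ∈ Metric.ball y₀ r, (∀ u, P y (fderiv ℝ x y u) = fderiv ℝ z y u) ∧
      (∀ u v, P y (fderiv ℝ (fderiv ℝ x) y u v) = fderiv ℝ (fderiv ℝ z) y u v) ∧
      ∀ a b, inner ℝ (P y a) (P y b) = inner ℝ a b := by
    intro y hy
    obtain ⟨Q, hQ1, hQ2⟩ := h.exists_isometry (hB y hy) (hball y hy).2.1
    obtain ⟨e, he⟩ := hEinv y hy
    have hQP : ∀ a, P y a = Q a := by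
      intro a
      obtain ⟨p, rfl⟩ := e.surjective a
      have h1 : P y (e p) = E z y p := by
        change E z y ((E x y).inverse (e p)) = _
        rw [he, ContinuousLinearMap.inverse_equiv]
        simp
      have h2 : e p = E x y p := by rw [he]; rfl
      rw [h1, h2, hE, hE, map_add, map_smul, hQ1, hQ2]
    exact ⟨fun u => by rw [hQP, hQ1], fun u v => by rw [hQP, hQ2],
      fun a b => by rw [hQP, hQP, Q.inner_map_map]⟩
  have hPder : ∀ y ∈ Metric.ball y₀ r, fderiv ℝ P y = 0 := by
    intro y hy
    have hnb : Metric.ball y₀ r ∈ 𝓝 y := Metric.isOpen_ball.mem_nhds hy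
    have hyU := hB y hy
    have hPy := (hPd y hy).hasFDerivAt
    obtain ⟨p1, p2, p3⟩ := hPiso y hy
    have hPa : ∀ a, HasFDerivAt (fun y => P y a) ((fderiv ℝ P y).flip a) y :=
      fun a => hPy.clm_apply_const a
    -- Differentiate P(dx u) = dz u; the second-order terms cancel because P also carries second
    -- derivatives of x to those of z.
    have htan : ∀ w u, fderiv ℝ P y w (fderiv ℝ x y u) = 0 := by
      intro w u
      have h1 := hPy.clm_apply (hasFDerivAt_fderiv_apply (h.smooth y hyU) u)
      have h2 : HasFDerivAt (fun y => P y (fderiv ℝ x y u)) _ y :=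
        (hasFDerivAt_fderiv_apply (h.smooth_normal y hyU) u).congr_of_eventuallyEq
          (by filter_upwards [hnb] with y' hy' using (hPiso y' hy').1 u)
      have h3 := congrArg (fun T : Eucl 3 →L[ℝ] Eucl 4 => T w) (h1.unique h2)
      simpa [p2] using h3
    have hskew : ∀ w a b, inner ℝ (P y a) (fderiv ℝ P y w b) +
        inner ℝ (fderiv ℝ P y w a) (P y b) = 0 := fun w a b =>
      inner_deriv_eq_zero (hPa a) (hPa b)
        (by filter_upwards [hnb] with y' hy' using (hPiso y' hy').2.2 a b) w
    -- Differentiated orthogonality of P, with `htan`, makes this vector orthogonal to the image of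
    -- dz and to P z, which together span 𝔼⁴.
    have hnor : ∀ w, fderiv ℝ P y w (z y) = 0 := by
      intro w
      refine eq_zero_of_orthogonal (h.injective_normal hyU) (N := P y (z y)) ?_ ?_ ?_ ?_
      · intro h0
        have := p3 (z y) (z y)
        rw [h0, inner_zero_left] at this
        exact h.ne_zero hyU (inner_self_eq_zero.1 this.symm)
      · intro u
        rw [← p1, p3, h.normal y hyU]
      · intro u
        have := hskew w (fderiv ℝ x y u) (z y)
        rwa [htan, inner_zero_left, add_zero, p1] at this
      · have := hskew w (z y) (z y)
        rw [real_inner_comm] at this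
        linarith
    ext w a : 2
    obtain ⟨γ, hγ⟩ := exists_decomp (h.injective y hyU) (h.ne_zero hyU) (h.normal y hyU) a
    rw [hγ, map_add, map_smul, htan, hnor]
    simp
  have hconst : ∀ y ∈ Metric.ball y₀ r, P y = P y₀ := fun y hy =>
    Metric.isOpen_ball.is_const_of_fderiv_eq_zero (convex_ball y₀ r).isPreconnected
      (fun y hy => (hPd y hy).differentiableWithinAt) hPder hy (Metric.mem_ball_self hr)
  refine ⟨r, hr, P y₀, hB, (hPiso y₀ (Metric.mem_ball_self hr)).2.2,
    fun y hy => (hball y hy).2.1, fun y hy u => ?_⟩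
  rw [← hconst y hy, (hPiso y hy).1]

/-- On tangent vectors this is the symmetry of ⟨dx, dz⟩. The mixed tangent-normal part has defect μ;
differentiating the tangential symmetry gives β(w,u) μ(v) = β(w,v) μ(u), so a nonzero μ would make
its kernel degenerate for β. -/
lemma inner_map_comm (h : IsometricNormalPair c U x z) {P : Eucl 4 →L[ℝ] Eucl 4}
    (hP : ∀ y ∈ U, ∀ u, fderiv ℝ z y u = P (fderiv ℝ x y u)) {y : Eucl 3} (hy : y ∈ U)
    (hn : Nondeg x z y) (a b : Eucl 4) : inner ℝ (P a) b = inner ℝ a (P b) := by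
  have hz := h.ne_zero hy
  have hzz : inner ℝ (z y) (z y) ≠ 0 := inner_self_ne_zero.2 hz
  have hdec := exists_decomp (h.injective y hy) hz (h.normal y hy)
  have htt : ∀ w ∈ U, ∀ u v, inner ℝ (P (fderiv ℝ x w u)) (fderiv ℝ x w v) =
      inner ℝ (fderiv ℝ x w u) (P (fderiv ℝ x w v)) := by
    intro w hw u v
    rw [← hP w hw, ← hP w hw, h.symm hw u v, real_inner_comm]
  set μ : Eucl 3 → ℝ := fun v =>
    inner ℝ (P (fderiv ℝ x y v)) (z y) - inner ℝ (fderiv ℝ x y v) (P (z y)) with hμ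
  set β : Eucl 3 → Eucl 3 → ℝ := fun u v => inner ℝ (fderiv ℝ (fderiv ℝ x) y u v) (z y) with hβ
  have hPd : ∀ u, HasFDerivAt (fun y => P (fderiv ℝ x y u))
      (P.comp ((fderiv ℝ (fderiv ℝ x) y).flip u)) y := fun u =>
    P.hasFDerivAt.comp y (hasFDerivAt_fderiv_apply (h.smooth y hy) u)
  have hpair : ∀ u v w, β w u * μ v = β w v * μ u := by
    intro u v w
    have h1 := inner_deriv_congr (hPd u) (hasFDerivAt_fderiv_apply (h.smooth y hy) v)
      (hasFDerivAt_fderiv_apply (h.smooth y hy) u) (hPd v)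
      (by filter_upwards [h.isOpen.mem_nhds hy] with w hw using htt w hw u v) w
    simp only [ContinuousLinearMap.flip_apply, ContinuousLinearMap.comp_apply] at h1
    obtain ⟨γ, hγ⟩ := hdec (fderiv ℝ (fderiv ℝ x) y w u)
    obtain ⟨δ, hδ⟩ := hdec (fderiv ℝ (fderiv ℝ x) y w v)
    rw [hγ, hδ] at h1
    simp only [map_add, map_smul, inner_add_left, inner_add_right, real_inner_smul_left,
      real_inner_smul_right, htt y hy] at h1
    have h2 : β w u / inner ℝ (z y) (z y) * μ v = β w v / inner ℝ (z y) (z y) * μ u := by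
      simp only [hβ, hμ]
      rw [real_inner_comm (P (z y)) (fderiv ℝ x y v), real_inner_comm (z y) (P (fderiv ℝ x y v))]
      linarith
    field_simp at h2
    linarith
  have hsmul : ∀ u v s, μ (s • u + v) = s * μ u + μ v := by
    intro u v s
    simp only [hμ, map_add, map_smul, inner_add_left, real_inner_smul_left]
    ring
  have hker : ∀ u, u ≠ 0 → μ u ≠ 0 ∨ ∀ v, μ v = 0 := by
    intro u hu
    by_contra! hcon
    obtain ⟨h0, v, hv⟩ := hcon
    apply hu
    apply hn
    intro w
    have h3 := hpair u v w
    rw [h0, mul_zero] at h3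
    rw [fderiv_fderiv_symm (h.smooth y hy)]
    exact (mul_eq_zero.1 h3).resolve_right hv
  have hμ0 : ∀ v, μ v = 0 := by
    have hne : (EuclideanSpace.single 0 (1 : ℝ) : Eucl 3) ≠ 0 := by simp
    rcases hker _ hne with h0 | h0
    -- A nonzero vector of ker μ, chosen in the plane of the first two basis vectors.
    · have hu : (-(μ (EuclideanSpace.single 1 1) / μ (EuclideanSpace.single 0 1))) •
          (EuclideanSpace.single 0 (1 : ℝ) : Eucl 3) + EuclideanSpace.single 1 1 ≠ 0 := by
        intro hcon
        have := congrArg (fun v : Eucl 3 => v 1) hcon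
        simp at this
      rcases hker _ hu with h1 | h1
      · refine absurd ?_ h1
        rw [hsmul]
        field_simp
        ring
      · exact h1
    · exact h0
  have hμ1 : ∀ v, inner ℝ (P (fderiv ℝ x y v)) (z y) = inner ℝ (fderiv ℝ x y v) (P (z y)) :=
    fun v => sub_eq_zero.1 (hμ0 v)
  obtain ⟨γ, hγ⟩ := hdec a
  obtain ⟨δ, hδ⟩ := hdec b
  rw [hγ, hδ]
  simp only [map_add, map_smul, inner_add_left, inner_add_right, real_inner_smul_left,
      real_inner_smul_right, htt y hy, hμ1]
  rw [real_inner_comm (fderiv ℝ x y δ) (P (z y)), ← hμ1, real_inner_comm (z y) (P (z y)),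
    real_inner_comm (P (fderiv ℝ x y δ)) (z y)]

/-- If `dz = P ∘ dx` for a fixed isometry `P` on a ball, then `dz = dx` there. -/
lemma fderiv_eq_of_isometry {y₀ : Eucl 3} {r : ℝ}
    (h : IsometricNormalPair c (Metric.ball y₀ r) x z) {P : Eucl 4 →L[ℝ] Eucl 4}
    (hiso : ∀ a b, inner ℝ (P a) (P b) = inner ℝ a b)
    (hn : ∀ y ∈ Metric.ball y₀ r, Nondeg x z y)
    (hP : ∀ y ∈ Metric.ball y₀ r, ∀ u, fderiv ℝ z y u = P (fderiv ℝ x y u))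
    {y : Eucl 3} (hy : y ∈ Metric.ball y₀ r) (u : Eucl 3) : fderiv ℝ z y u = fderiv ℝ x y u := by
  have hself : ∀ a b, inner ℝ (P a) b = inner ℝ a (P b) := h.inner_map_comm hP hy (hn y hy)
  have hPP : ∀ a, P (P a) = a := fun a => ext_inner_right ℝ fun b => by rw [hself, hiso]
  have hzd : ∀ w ∈ Metric.ball y₀ r, HasFDerivAt z (fderiv ℝ z w) w := fun w hw =>
    h.hasFDerivAt_normal hw
  have hPzd : ∀ w ∈ Metric.ball y₀ r, HasFDerivAt (fun w => P (z w)) (P.comp (fderiv ℝ z w)) w :=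
    fun w hw => P.hasFDerivAt.comp w (hzd w hw)
  have hpre : IsPreconnected (Metric.ball y₀ r) := (convex_ball y₀ r).isPreconnected
  -- ⟨Pz, dz v⟩ = ⟨Pz, P dx v⟩ = ⟨z, dx v⟩ = 0, so ⟨Pz, z⟩ has zero derivative.
  have hρ : ∀ w ∈ Metric.ball y₀ r, inner ℝ (P (z w)) (z w) = inner ℝ (P (z y)) (z y) := by
    intro w hw
    refine Metric.isOpen_ball.is_const_of_fderiv_eq_zero (𝕜 := ℝ)
      (f := fun w => inner ℝ (P (z w)) (z w)) hpre
      (fun w hw => ((hPzd w hw).inner ℝ (hzd w hw)).differentiableAt.differentiableWithinAt)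
      (fun w hw => ?_) hw hy
    refine ((hPzd w hw).inner ℝ (hzd w hw)).fderiv.trans ?_
    ext v
    have h1 : inner ℝ (P (z w)) (fderiv ℝ z w v) = 0 := by
      rw [hP w hw, hiso, real_inner_comm, h.normal w hw]
    have h2 : inner ℝ (P (fderiv ℝ z w v)) (z w) = 0 := by rw [hself, real_inner_comm, h1]
    simp [fderivInnerCLM_apply, h1, h2]
  set ρ := inner ℝ (P (z y)) (z y)
  set τ := LinearMap.trace ℝ _ P.toLinearMap
  set q : Eucl 3 → ℝ := fun w => inner ℝ (z w) (z w) with hq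
  have hqpos : ∀ w ∈ Metric.ball y₀ r, 0 < q w := fun w hw => real_inner_self_pos.2 (h.ne_zero hw)
  -- In a frame adapted to z, tr P = c q + ρ/q; both tr P and ρ are constant.
  have hquad : ∀ w ∈ Metric.ball y₀ r, c * q w ^ 2 - τ * q w + ρ = 0 := by
    intro w hw
    obtain ⟨e, he⟩ := exists_orthonormal_comp (h.injective w hw)
    have h1 := trace_eq_sum_adapted he (h.ne_zero hw) (fun k => h.normal w hw _) P.toLinearMap
    have h2 := h.trace w hw e he
    simp only [hP w hw] at h2
    simp only [ContinuousLinearMap.coe_coe, h2] at h1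
    rw [real_inner_comm (P (z w)) (z w), hρ w hw] at h1
    have h3 := (hqpos w hw).ne'
    change τ = c * q w + ρ / q w at h1
    field_simp at h1
    linarith
  have hqcont : ContinuousOn q (Metric.ball y₀ r) := fun w hw =>
    ((hzd w hw).continuousAt.inner (hzd w hw).continuousAt).continuousWithinAt
  -- Two distinct values of q would, by connectedness, make their midpoint a third root of the
  -- quadratic.
  have hqconst : ∀ w ∈ Metric.ball y₀ r, ∀ w' ∈ Metric.ball y₀ r, ¬ q w < q w' := by
    intro w hw w' hw' hlt
    obtain ⟨v, hv, hvm⟩ := (hpre.image q hqcont).Icc_subset (Set.mem_image_of_mem q hw)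
      (Set.mem_image_of_mem q hw') (show (q w + q w') / 2 ∈ _ from ⟨by linarith, by linarith⟩)
    have e1 := hquad w hw
    have e2 := hquad w' hw'
    have e3 := hquad v hv
    rw [hvm] at e3
    have : c * (q w' - q w) ^ 2 = 0 := by linear_combination 2 * e1 + 2 * e2 - 4 * e3
    rcases mul_eq_zero.1 this with h0 | h0
    · exact h.pos.ne' h0
    · have := pow_eq_zero_iff (two_ne_zero) |>.1 h0
      linarith
  have hq' : ∀ w ∈ Metric.ball y₀ r, q w = q y := fun w hw =>
    le_antisymm (not_lt.1 (hqconst y hy w hw)) (not_lt.1 (hqconst w hw y hy))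
  -- Constancy of |z|² gives 0 = ⟨z, dz v⟩ = ⟨Pz, dx v⟩, so Pz is again normal.
  have heig : ∀ w ∈ Metric.ball y₀ r, P (z w) = (ρ / q y) • z w := by
    intro w hw
    have h1 : ∀ v, inner ℝ (fderiv ℝ x w v) (P (z w)) = 0 := by
      intro v
      have h2 := inner_deriv_eq_zero (hzd w hw) (hzd w hw)
        (by filter_upwards [Metric.isOpen_ball.mem_nhds hw] with w' hw' using hq' w' hw') v
      rw [real_inner_comm, hP w hw, hself] at h2
      linarith
    rw [eq_smul_of_orthogonal (h.injective w hw) (h.ne_zero hw) (h.normal w hw) h1, hρ w hw]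
    congr 2
    exact hq' w hw
  set l := ρ / q y with hl
  have hll : l * l = 1 := by
    have h1 := hPP (z y)
    rw [heig y hy, map_smul, heig y hy, smul_smul] at h1
    have h2 : (l * l - 1) • z y = 0 := by rw [sub_smul, h1, one_smul, sub_self]
    rcases smul_eq_zero.1 h2 with h3 | h3
    · linarith
    · exact absurd h3 (h.ne_zero hy)
  have hPx : ∀ v, P (fderiv ℝ x y v) = l • fderiv ℝ x y v := by
    intro v
    have h1 : HasFDerivAt (fun w => P (z w)) (l • fderiv ℝ z y) y :=
      ((hzd y hy).const_smul l).congr_of_eventuallyEq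
        (by filter_upwards [Metric.isOpen_ball.mem_nhds hy] with w hw using heig w hw)
    have h2 := congrArg (fun T : Eucl 3 →L[ℝ] Eucl 4 => T v) ((hPzd y hy).unique h1)
    simp only [ContinuousLinearMap.comp_apply, smul_apply, hP y hy, hPP] at h2
    conv_rhs => rw [h2, smul_smul, hll, one_smul]
  -- The trace condition reads 3l = c|z|² > 0.
  have hl1 : l = 1 := by
    obtain ⟨e, he⟩ := exists_orthonormal_comp (h.injective y hy)
    have h2 := h.trace y hy e he
    have he' := orthonormal_iff_ite.1 he
    simp only [hP y hy, hPx, real_inner_smul_right, he', if_true] at h2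
    simp at h2
    have h3 := mul_pos h.pos (hqpos y hy)
    simp only [hq, real_inner_self_eq_norm_sq] at h3
    have h4 : (l - 1) * (l + 1) = 0 := by linear_combination hll
    rcases mul_eq_zero.1 h4 with h5 | h5
    · linarith
    · nlinarith
  rw [hP y hy, hPx, hl1, one_smul]

lemma fderiv_eq_of_nondeg (h : IsometricNormalPair c U x z) {y : Eucl 3} (hy : y ∈ U)
    (hn : Nondeg x z y) (u : Eucl 3) : fderiv ℝ z y u = fderiv ℝ x y u := by
  obtain ⟨r, hr, P, hU, hiso, hnd, hP⟩ := h.exists_local_isometry hy hn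
  exact (h.mono Metric.isOpen_ball hU).fderiv_eq_of_isometry hiso hnd hP
    (Metric.mem_ball_self hr) u

/-- The normal field of an isometric normal pair differs from the position by a translation. -/
theorem fderiv_eq (h : IsometricNormalPair c U x z) {y : Eucl 3} (hy : y ∈ U) :
    fderiv ℝ z y = fderiv ℝ x y := by
  by_contra hne
  have hcx : ContinuousAt (fderiv ℝ x) y :=
    ((h.smooth y hy).fderiv_right (m := ∞) (by simp)).continuousAt
  have hcz : ContinuousAt (fderiv ℝ z) y :=
    ((h.smooth_normal y hy).fderiv_right (m := ∞) (by simp)).continuousAt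
  -- dz ≠ dx is an open condition, and the nondegenerate case excludes it wherever the second form
  -- has full rank.
  have hev : ∀ᶠ w in 𝓝 y, w ∈ U ∧ ¬ Nondeg x z w := by
    filter_upwards [h.isOpen.mem_nhds hy, (hcz.sub hcx).eventually_ne (sub_ne_zero.2 hne)]
      with w hw hw'
    exact ⟨hw, fun hn => hw' (sub_eq_zero.2 (ContinuousLinearMap.ext
      (h.fderiv_eq_of_nondeg hw hn)))⟩
  have hdeg : ∀ w ∈ U, ¬ Nondeg x z w →
      ∃ u, u ≠ 0 ∧ ∀ v, inner ℝ (fderiv ℝ x w u) (fderiv ℝ z w v) = 0 := by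
    intro w hw hn
    unfold Nondeg at hn
    push Not at hn
    obtain ⟨u, hu, hu0⟩ := hn
    refine ⟨u, hu0, fun v => ?_⟩
    have := hu v
    rw [h.inner_second hw, h.symm hw] at this
    linarith
  have hlen : ∀ᶠ w in 𝓝 y, inner ℝ (z w) (z w) = 2 / c := by
    filter_upwards [hev] with w ⟨hw, hn⟩
    obtain ⟨u, hu, hu'⟩ := hdeg w hw hn
    obtain ⟨e, he⟩ := exists_orthonormal_comp (h.injective w hw)
    have htr := h.trace w hw e he
    -- The homothety constant is 1 here, z being already normalized; the trace c|z|² equals 2.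
    have := trace_of_degenerate one_pos (h.injective w hw) (h.ne_zero hw) (h.normal w hw)
      (h.symm hw) (by simpa using h.isometric w hw) he
      (by rw [htr]; exact mul_pos h.pos (real_inner_self_pos.2 (h.ne_zero hw))) hu hu'
    rw [htr] at this
    rw [eq_div_iff h.pos.ne']
    linarith
  obtain ⟨u, hu, hu'⟩ := hdeg y hy hev.self_of_nhds.2
  have hzu : fderiv ℝ z y u = 0 := by
    refine eq_zero_of_orthogonal (h.injective y hy) (h.ne_zero hy) (h.normal y hy) ?_ ?_
    · intro v
      rw [h.symm hy, hu']
    · have := inner_deriv_eq_zero (h.hasFDerivAt_normal hy) (h.hasFDerivAt_normal hy) hlen u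
      rw [real_inner_comm] at this
      linarith
  exact hu (h.injective_normal hy (by rw [hzu, map_zero]))

lemma inner_self_eq (h : IsometricNormalPair c U x z) {y : Eucl 3} (hy : y ∈ U) :
    inner ℝ (z y) (z y) = 3 / c := by
  obtain ⟨e, he⟩ := exists_orthonormal_comp (h.injective y hy)
  have h1 := h.trace y hy e he
  have he' := orthonormal_iff_ite.1 he
  simp only [h.fderiv_eq hy, he', if_true] at h1
  rw [eq_div_iff h.pos.ne', mul_comm, ← h1]
  simp

end IsometricNormalPair

end LocalTheorem

/-! ### Passage from the manifold to charts. -/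

section Charts

open Filter Topology

variable {M : Type*} [TopologicalSpace M] [ChartedSpace (Eucl 3) M] [IsManifold (𝓡 3) ∞ M]

lemma contMDiffAt_extChartAt_symm_of_mem {p : M} {y : Eucl 3}
    (hy : y ∈ (extChartAt (𝓡 3) p).target) :
    ContMDiffAt 𝓘(ℝ, Eucl 3) (𝓡 3) ∞ (extChartAt (𝓡 3) p).symm y :=
  (contMDiffOn_extChartAt_symm p).contMDiffAt ((isOpen_extChartAt_target p).mem_nhds hy)

lemma contDiffAt_comp_extChartAt_symm {f : M → Eucl 4}
    {p : M} {y : Eucl 3} (hy : y ∈ (extChartAt (𝓡 3) p).target)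
    (hf : ContMDiffAt (𝓡 3) 𝓘(ℝ, Eucl 4) ∞ f ((extChartAt (𝓡 3) p).symm y)) :
    ContDiffAt ℝ ∞ (f ∘ (extChartAt (𝓡 3) p).symm) y :=
  (hf.comp y (contMDiffAt_extChartAt_symm_of_mem hy)).contDiffAt

lemma fderiv_comp_extChartAt_symm {f : M → Eucl 4}
    {p : M} {y : Eucl 3} (hy : y ∈ (extChartAt (𝓡 3) p).target)
    (hf : ContMDiffAt (𝓡 3) 𝓘(ℝ, Eucl 4) ∞ f ((extChartAt (𝓡 3) p).symm y)) (u : Eucl 3) :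
    fderiv ℝ (f ∘ (extChartAt (𝓡 3) p).symm) y u =
      differential f ((extChartAt (𝓡 3) p).symm y)
        (mfderiv 𝓘(ℝ, Eucl 3) (𝓡 3) (extChartAt (𝓡 3) p).symm y u) := by
  rw [← mfderiv_eq_fderiv, mfderiv_comp y (hf.mdifferentiableAt (by simp))
    ((contMDiffAt_extChartAt_symm_of_mem hy).mdifferentiableAt (by simp))]
  rfl

lemma mfderiv_extChartAt_symm_injective {p : M} {y : Eucl 3}
    (hy : y ∈ (extChartAt (𝓡 3) p).target) :
    Function.Injective (mfderiv 𝓘(ℝ, Eucl 3) (𝓡 3) (extChartAt (𝓡 3) p).symm y) := by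
  have h := mfderiv_extChartAt_comp_mfderivWithin_extChartAt_symm (I := 𝓡 3) hy
  rw [ModelWithCorners.range_eq_univ, mfderivWithin_univ] at h
  intro a b hab
  have h' : ∀ v, mfderiv (𝓡 3) 𝓘(ℝ, Eucl 3) (extChartAt (𝓡 3) p) ((extChartAt (𝓡 3) p).symm y)
      (mfderiv 𝓘(ℝ, Eucl 3) (𝓡 3) (extChartAt (𝓡 3) p).symm y v) = v :=
    fun v => DFunLike.congr_fun h v
  rw [← h' a, ← h' b, hab]

variable {g : SmoothMetric 3 M} {x : M → Eucl 4}

namespace IsIsometricImmersion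

lemma contDiffAt_chart (hx : IsIsometricImmersion g x) {p : M} {y : Eucl 3}
    (hy : y ∈ (extChartAt (𝓡 3) p).target) :
    ContDiffAt ℝ ∞ (x ∘ (extChartAt (𝓡 3) p).symm) y :=
  contDiffAt_comp_extChartAt_symm hy hx.1.contMDiffAt

lemma inner_fderiv (hx : IsIsometricImmersion g x) {p : M} {y : Eucl 3}
    (hy : y ∈ (extChartAt (𝓡 3) p).target) (u v : Eucl 3) :
    inner ℝ (fderiv ℝ (x ∘ (extChartAt (𝓡 3) p).symm) y u)
      (fderiv ℝ (x ∘ (extChartAt (𝓡 3) p).symm) y v) =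
    g.inner ((extChartAt (𝓡 3) p).symm y)
      (mfderiv 𝓘(ℝ, Eucl 3) (𝓡 3) (extChartAt (𝓡 3) p).symm y u)
      (mfderiv 𝓘(ℝ, Eucl 3) (𝓡 3) (extChartAt (𝓡 3) p).symm y v) := by
  rw [fderiv_comp_extChartAt_symm hy hx.1.contMDiffAt,
    fderiv_comp_extChartAt_symm hy hx.1.contMDiffAt, hx.2]

lemma injective_fderiv (hx : IsIsometricImmersion g x) {p : M} {y : Eucl 3}
    (hy : y ∈ (extChartAt (𝓡 3) p).target) :
    Function.Injective (fderiv ℝ (x ∘ (extChartAt (𝓡 3) p).symm) y) := by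
  rw [injective_iff_map_eq_zero]
  intro u hu
  by_contra hne
  have h1 := hx.inner_fderiv hy u u
  rw [hu, inner_zero_left] at h1
  refine (g.pos _ _ ?_).ne h1
  intro h0
  exact hne (mfderiv_extChartAt_symm_injective hy (h0.trans (map_zero _).symm))

lemma metricMatrix_eq (hx : IsIsometricImmersion g x) {p : M} {y : Eucl 3}
    (hy : y ∈ (extChartAt (𝓡 3) p).target) :
    metricMatrix g p y = coordGram (x ∘ (extChartAt (𝓡 3) p).symm) y := by
  ext i j
  exact (hx.inner_fderiv hy _ _).symm

lemma laplaceMap_eq (hx : IsIsometricImmersion g x) (p : M) :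
    laplaceMap g x p =
      chartLap (x ∘ (extChartAt (𝓡 3) p).symm) (extChartAt (𝓡 3) p p) := by
  have hp := mem_extChartAt_target (I := 𝓡 3) p
  unfold laplaceMap laplaceOp chartLap
  rw [hx.metricMatrix_eq hp]
  congr 2
  refine Finset.sum_congr rfl fun i _ => ?_
  unfold partialD
  congr 1
  refine Filter.EventuallyEq.fderiv_eq ?_
  filter_upwards [(isOpen_extChartAt_target p).mem_nhds hp] with y hy
  rw [hx.metricMatrix_eq hy]

/-- The Laplace map at q is computed in the preferred chart of q. Coordinate independence moves it
to one fixed chart around p, so that it can be differentiated there. -/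
lemma laplaceMap_symm (hx : IsIsometricImmersion g x) {p : M} {y : Eucl 3}
    (hy : y ∈ (extChartAt (𝓡 3) p).target) :
    laplaceMap g x ((extChartAt (𝓡 3) p).symm y) =
      chartLap (x ∘ (extChartAt (𝓡 3) p).symm) y := by
  set q := (extChartAt (𝓡 3) p).symm y with hq
  rw [hx.laplaceMap_eq]
  have hqt := mem_extChartAt_target (I := 𝓡 3) q
  have hsymm := contMDiffAt_extChartAt_symm_of_mem hy
  symm
  refine chartLap_comp (ψ := extChartAt (𝓡 3) q ∘ (extChartAt (𝓡 3) p).symm)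
    (hx.contDiffAt_chart hy) (hx.injective_fderiv hy) (hx.contDiffAt_chart hqt)
    (hx.injective_fderiv hqt) ?_ ?_
  · exact ((contMDiffAt_extChartAt (I := 𝓡 3) (x := q)).comp y hsymm).contDiffAt
  · filter_upwards [hsymm.continuousAt.preimage_mem_nhds
      (extChartAt_source_mem_nhds (I := 𝓡 3) q)] with w hw
    simp only [Function.comp_apply]
    rw [(extChartAt (𝓡 3) q).left_inv hw]

lemma contMDiffAt_laplaceMap (hx : IsIsometricImmersion g x) (p : M) :
    ContMDiffAt (𝓡 3) 𝓘(ℝ, Eucl 4) ∞ (laplaceMap g x) p := by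
  have hp := mem_extChartAt_target (I := 𝓡 3) p
  have h1 := (contDiffAt_chartLap (hx.contDiffAt_chart hp) (hx.injective_fderiv hp)).contMDiffAt
  refine (h1.comp p contMDiffAt_extChartAt).congr_of_eventuallyEq ?_
  filter_upwards [extChartAt_source_mem_nhds (I := 𝓡 3) p] with q hq
  rw [Function.comp_apply, ← hx.laplaceMap_symm ((extChartAt (𝓡 3) p).map_source hq),
    (extChartAt (𝓡 3) p).left_inv hq]

lemma isometricNormalPair (hx : IsIsometricImmersion g x) {c : ℝ} (hc : 0 < c)
    (hL : ∀ (p : M) (X Y : TangentSpace (𝓡 3) p),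
      inner ℝ (differential (laplaceMap g x) p X) (differential (laplaceMap g x) p Y) =
        c ^ 2 * g.inner p X Y) (p : M) :
    IsometricNormalPair c (extChartAt (𝓡 3) p).target (x ∘ (extChartAt (𝓡 3) p).symm)
      (fun y => c⁻¹ • laplaceMap g x ((extChartAt (𝓡 3) p).symm y)) := by
  have hsm : ∀ y ∈ (extChartAt (𝓡 3) p).target,
      ContDiffAt ℝ ∞ (laplaceMap g x ∘ (extChartAt (𝓡 3) p).symm) y := fun y hy =>
    contDiffAt_comp_extChartAt_symm hy (hx.contMDiffAt_laplaceMap _)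
  have hder : ∀ y ∈ (extChartAt (𝓡 3) p).target, ∀ u,
      fderiv ℝ (fun y => c⁻¹ • laplaceMap g x ((extChartAt (𝓡 3) p).symm y)) y u =
        c⁻¹ • fderiv ℝ (laplaceMap g x ∘ (extChartAt (𝓡 3) p).symm) y u := by
    intro y hy u
    have := (((hsm y hy).differentiableAt (by simp)).hasFDerivAt.const_smul c⁻¹).fderiv
    exact congrArg (fun T : Eucl 3 →L[ℝ] Eucl 4 => T u) this
  have hnor : ∀ y ∈ (extChartAt (𝓡 3) p).target, ∀ u,
      inner ℝ (fderiv ℝ (x ∘ (extChartAt (𝓡 3) p).symm) y u)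
        ((laplaceMap g x ∘ (extChartAt (𝓡 3) p).symm) y) = 0 := by
    intro y hy u
    rw [Function.comp_apply, hx.laplaceMap_symm hy, real_inner_comm,
      inner_chartLap_fderiv (hx.contDiffAt_chart hy) (hx.injective_fderiv hy)]
  refine ⟨hc, isOpen_extChartAt_target p, fun y hy => hx.contDiffAt_chart hy,
    fun y hy => (hsm y hy).const_smul c⁻¹, fun y hy => hx.injective_fderiv hy, ?_, ?_, ?_⟩
  · intro y hy u
    rw [real_inner_smul_right]
    exact mul_eq_zero_of_right _ (hnor y hy u)
  · intro y hy u v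
    rw [hder y hy, hder y hy, real_inner_smul_left, real_inner_smul_right,
      fderiv_comp_extChartAt_symm hy (hx.contMDiffAt_laplaceMap _),
      fderiv_comp_extChartAt_symm hy (hx.contMDiffAt_laplaceMap _), hL, hx.inner_fderiv hy]
    field_simp
  · intro y hy e he
    -- Derivative of ⟨dx u, L⟩ = 0. Summed over a frame, it turns the trace formula for ⟨L, L⟩ into
    -- the trace of ⟨dx, dL⟩.
    have hsec : ∀ u, inner ℝ (fderiv ℝ (fderiv ℝ (x ∘ (extChartAt (𝓡 3) p).symm)) y u u)
        ((laplaceMap g x ∘ (extChartAt (𝓡 3) p).symm) y) =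
        -inner ℝ (fderiv ℝ (x ∘ (extChartAt (𝓡 3) p).symm) y u)
          (fderiv ℝ (laplaceMap g x ∘ (extChartAt (𝓡 3) p).symm) y u) := by
      intro u
      have := inner_deriv_eq_zero (hasFDerivAt_fderiv_apply (hx.contDiffAt_chart hy) u)
        ((hsm y hy).differentiableAt (by simp)).hasFDerivAt (k := 0)
        (by filter_upwards [(isOpen_extChartAt_target p).mem_nhds hy] with w hw
              using hnor w hw u) u
      simp only [ContinuousLinearMap.flip_apply] at this
      linarith
    have h1 := inner_chartLap_normal (hx.contDiffAt_chart hy) (hx.injective_fderiv hy)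
      (hnor y hy) he
    simp only [hsec, Finset.sum_neg_distrib, neg_neg] at h1
    rw [← hx.laplaceMap_symm hy] at h1
    simp only [hder y hy, real_inner_smul_right, ← Finset.mul_sum, ← h1, real_inner_smul_left]
    rw [Function.comp_apply]
    field_simp

end IsIsometricImmersion

end Charts

/-! ### Spheres: openness of the image, the centre, and the converse. -/

section Global

open Filter Topology

/-- A hypersurface immersed into a hypersphere is an open part of it. -/
lemma range_union_compl_sphere_mem_nhds {X : Eucl 3 → Eucl 4} {y : Eucl 3} {a : Eucl 4} {r : ℝ}
    (hr : 0 < r) (hX : ContDiffAt ℝ ∞ X y) (hinj : Function.Injective (fderiv ℝ X y))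
    {U : Set (Eucl 3)} (hU : U ∈ 𝓝 y) (hsphere : ∀ w ∈ U, X w ∈ Metric.sphere a r) :
    X '' U ∪ (Metric.sphere a r)ᶜ ∈ 𝓝 (X y) := by
  have hyU := mem_of_mem_nhds hU
  have hXd : HasFDerivAt X (fderiv ℝ X y) y := (hX.differentiableAt (by simp)).hasFDerivAt
  have hne : X y - a ≠ 0 := by
    intro h0
    have := hsphere y hyU
    rw [mem_sphere_iff_norm, h0, norm_zero] at this
    exact hr.ne this
  have hnor : ∀ u, inner ℝ (fderiv ℝ X y u) (X y - a) = 0 := by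
    intro u
    have := inner_deriv_eq_zero (hXd.sub_const a) (hXd.sub_const a) (k := r ^ 2)
      (by filter_upwards [hU] with w hw
          rw [real_inner_self_eq_norm_sq, mem_sphere_iff_norm.1 (hsphere w hw)]) u
    rw [real_inner_comm] at this
    linarith
  -- Radial thickening of X. Its differential at (y, 0) is onto, so it maps neighbourhoods onto
  -- neighbourhoods; for t > -1 it meets the sphere only at t = 0.
  let Φ : Eucl 3 × ℝ → Eucl 4 := fun p => a + (1 + p.2) • (X p.1 - a)
  have hΦs : ContDiffAt ℝ ∞ Φ (y, 0) := by
    have h1 : ContDiffAt ℝ ∞ (fun p : Eucl 3 × ℝ => X p.1) (y, 0) :=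
      ContDiffAt.comp (y, 0) hX contDiffAt_fst
    exact contDiffAt_const.add ((contDiffAt_const.add contDiffAt_snd).smul
      (h1.sub contDiffAt_const))
  have hΦd : ∀ u s, fderiv ℝ Φ (y, 0) (u, s) = fderiv ℝ X y u + s • (X y - a) := by
    intro u s
    have h1 : HasFDerivAt (fun p : Eucl 3 × ℝ => X p.1 - a)
        ((fderiv ℝ X y).comp (ContinuousLinearMap.fst ℝ (Eucl 3) ℝ)) (y, 0) :=
      (HasFDerivAt.comp (y, (0 : ℝ)) hXd hasFDerivAt_fst).sub_const a
    have h2 : HasFDerivAt (fun p : Eucl 3 × ℝ => 1 + p.2)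
        (ContinuousLinearMap.snd ℝ (Eucl 3) ℝ) (y, (0 : ℝ)) := hasFDerivAt_snd.const_add 1
    have h3 : HasFDerivAt Φ _ (y, 0) := (h2.smul h1).const_add a
    rw [h3.fderiv]
    simp
  have hsurj : (fderiv ℝ Φ (y, 0)).range = ⊤ := by
    rw [LinearMap.range_eq_top]
    intro b
    obtain ⟨γ, hγ⟩ := exists_decomp hinj hne hnor b
    exact ⟨(γ, _), (hΦd _ _).trans hγ.symm⟩
  have hmap := (hΦs.hasStrictFDerivAt (by simp)).map_nhds_eq_of_surj hsurj
  have hΦ0 : Φ (y, 0) = X y := by simp [Φ]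
  rw [hΦ0] at hmap
  rw [← hmap, Filter.mem_map]
  have hmem : U ×ˢ Set.Ioi (-1 : ℝ) ∈ 𝓝 (y, (0 : ℝ)) :=
    prod_mem_nhds hU (Ioi_mem_nhds (by norm_num))
  filter_upwards [hmem]
  rintro ⟨w, t⟩ ⟨hw, ht⟩
  by_cases hS : Φ (w, t) ∈ Metric.sphere a r
  · left
    refine ⟨w, hw, ?_⟩
    have ht' : 0 < 1 + t := by
      have : -1 < t := ht
      linarith
    have h1 : (1 + t) * r = r := by
      rw [mem_sphere_iff_norm] at hS
      simp only [Φ, add_sub_cancel_left, norm_smul, Real.norm_eq_abs, abs_of_pos ht'] at hS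
      rwa [mem_sphere_iff_norm.1 (hsphere w hw)] at hS
    have h2 : t = 0 := by
      have : t * r = 0 := by linarith
      exact (mul_eq_zero.1 this).resolve_right hr.ne'
    simp [Φ, h2]
  · exact Or.inr hS

variable {M : Type*} [TopologicalSpace M] [ChartedSpace (Eucl 3) M] [IsManifold (𝓡 3) ∞ M]
  {g : SmoothMetric 3 M} {x : M → Eucl 4}

lemma IsIsometricImmersion.isOpenPartOfHypersphere (hx : IsIsometricImmersion g x) {a : Eucl 4}
    {r : ℝ} (hr : 0 < r) (hsphere : ∀ p, x p ∈ Metric.sphere a r) :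
    IsOpenPartOfHypersphere x := by
  -- The largest open set that meets the sphere only in points of the image.
  refine ⟨a, r, hr, interior (Set.range x ∪ (Metric.sphere a r)ᶜ), isOpen_interior, ?_⟩
  apply Set.Subset.antisymm
  · rintro _ ⟨p, rfl⟩
    refine ⟨hsphere p, mem_interior_iff_mem_nhds.2 ?_⟩
    have hp := mem_extChartAt_target (I := 𝓡 3) p
    have h := range_union_compl_sphere_mem_nhds hr (hx.contDiffAt_chart hp)
      (hx.injective_fderiv hp) ((isOpen_extChartAt_target p).mem_nhds hp)
      (fun w _ => hsphere _)
    rw [Function.comp_apply, extChartAt_to_inv] at h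
    refine mem_of_superset h (Set.union_subset_union_left _ ?_)
    rintro _ ⟨w, _, rfl⟩
    exact ⟨_, rfl⟩
  · rintro w ⟨hw, hw'⟩
    exact (interior_subset hw').resolve_right fun h => h hw

lemma IsIsometricImmersion.exists_center [ConnectedSpace M] (hx : IsIsometricImmersion g x) {c : ℝ}
    (hc : 0 < c) (hL : ∀ (p : M) (X Y : TangentSpace (𝓡 3) p),
      inner ℝ (differential (laplaceMap g x) p X) (differential (laplaceMap g x) p Y) =
        c ^ 2 * g.inner p X Y) :
    ∃ a, ∀ p, x p ∈ Metric.sphere a (Real.sqrt (3 / c)) := by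
  have hpair := hx.isometricNormalPair hc hL
  -- The prospective centre x - z.
  let F : M → Eucl 4 := fun p => x p - c⁻¹ • laplaceMap g x p
  have hF : IsLocallyConstant F := by
    rw [IsLocallyConstant.iff_eventually_eq]
    intro p
    have hp := mem_extChartAt_target (I := 𝓡 3) p
    obtain ⟨s, hs, hball⟩ := Metric.isOpen_iff.1 (isOpen_extChartAt_target (I := 𝓡 3) p) _ hp
    have hd : ∀ y ∈ Metric.ball (extChartAt (𝓡 3) p p) s,
        HasFDerivAt (fun y => F ((extChartAt (𝓡 3) p).symm y)) (0 : Eucl 3 →L[ℝ] Eucl 4) y := by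
      intro y hy
      have h1 := ((hx.contDiffAt_chart (hball hy)).differentiableAt (by simp)).hasFDerivAt
      have h2 := h1.sub ((hpair p).hasFDerivAt_normal (hball hy))
      rw [(hpair p).fderiv_eq (hball hy), sub_self] at h2
      exact h2
    filter_upwards [extChartAt_source_mem_nhds (I := 𝓡 3) p,
      (continuousAt_extChartAt (I := 𝓡 3) p).preimage_mem_nhds (Metric.ball_mem_nhds _ hs)]
      with q hq hqb
    have h3 := Metric.isOpen_ball.is_const_of_fderiv_eq_zero (𝕜 := ℝ)
      (convex_ball (extChartAt (𝓡 3) p p) s).isPreconnected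
      (fun y hy => (hd y hy).differentiableAt.differentiableWithinAt)
      (fun y hy => (hd y hy).fderiv) hqb (Metric.mem_ball_self hs)
    rwa [(extChartAt (𝓡 3) p).left_inv hq, extChartAt_to_inv] at h3
  obtain ⟨p₀⟩ := (inferInstance : Nonempty M)
  refine ⟨F p₀, fun p => ?_⟩
  have h1 : x p - F p₀ = c⁻¹ • laplaceMap g x p := by
    rw [hF.apply_eq_of_preconnectedSpace p₀ p]
    simp [F]
  have h2 := (hpair p).inner_self_eq (mem_extChartAt_target (I := 𝓡 3) p)
  rw [extChartAt_to_inv, real_inner_self_eq_norm_sq] at h2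
  rw [mem_sphere_iff_norm, h1, ← h2, Real.sqrt_sq (norm_nonneg _)]

/-- The Laplacian of a parametrization of an open part of a hypersphere. -/
lemma chartLap_of_sphere {X : Eucl 3 → Eucl 4} {y : Eucl 3} {a : Eucl 4} {r : ℝ}
    (hr : 0 < r) (hX : ContDiffAt ℝ ∞ X y) (hinj : Function.Injective (fderiv ℝ X y))
    (hsphere : ∀ w, X w ∈ Metric.sphere a r) : chartLap X y = (3 / r ^ 2) • (X y - a) := by
  have hXw : ∀ᶠ w in 𝓝 y, HasFDerivAt X (fderiv ℝ X w) w :=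
    ((hX.of_le (m := 1) (by simp)).eventually (by simp)).mono fun w hw =>
      (hw.differentiableAt (by simp)).hasFDerivAt
  have hself : ∀ w, inner ℝ (X w - a) (X w - a) = r ^ 2 := fun w => by
    rw [real_inner_self_eq_norm_sq, mem_sphere_iff_norm.1 (hsphere w)]
  have hne : X y - a ≠ 0 := by
    intro h0
    have := hself y
    rw [h0, inner_zero_left] at this
    exact (pow_pos hr 2).ne this
  have hnor : ∀ᶠ w in 𝓝 y, ∀ u, inner ℝ (fderiv ℝ X w u) (X w - a) = 0 := by
    filter_upwards [hXw] with w hw u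
    have := inner_deriv_eq_zero (hw.sub_const a) (hw.sub_const a)
      (Filter.Eventually.of_forall hself) u
    rw [real_inner_comm] at this
    linarith
  -- On a sphere the position vector X - a is normal and its derivative is dX, so the second form in
  -- this direction is minus the metric, with trace -3.
  have hsec : ∀ u, inner ℝ (fderiv ℝ (fderiv ℝ X) y u u) (X y - a) =
      -inner ℝ (fderiv ℝ X y u) (fderiv ℝ X y u) := by
    intro u
    have := inner_deriv_eq_zero (hasFDerivAt_fderiv_apply hX u)
      (hXw.self_of_nhds.sub_const a) (k := 0) (hnor.mono fun w hw => hw u) u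
    simp only [ContinuousLinearMap.flip_apply] at this
    linarith
  obtain ⟨e, he⟩ := exists_orthonormal_comp hinj
  have h1 := inner_chartLap_normal hX hinj hnor.self_of_nhds he
  simp only [hsec, orthonormal_iff_ite.1 he, if_true] at h1
  rw [eq_smul_of_orthogonal hinj hne hnor.self_of_nhds (w := chartLap X y)
    (fun u => by rw [real_inner_comm, inner_chartLap_fderiv hX hinj]), h1, hself]
  simp

lemma IsIsometricImmersion.hasHomotheticLaplaceTransformation (hx : IsIsometricImmersion g x)
    (h : IsOpenPartOfHypersphere x) : HasHomotheticLaplaceTransformation g x := by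
  obtain ⟨a, r, hr, U, -, hU⟩ := h
  have hsphere : ∀ p, x p ∈ Metric.sphere a r := fun p =>
    (hU ▸ Set.mem_range_self p : x p ∈ Metric.sphere a r ∩ U).1
  have hL : laplaceMap g x = (fun w => (3 / r ^ 2) • (w - a)) ∘ x := by
    ext1 p
    have hp := mem_extChartAt_target (I := 𝓡 3) p
    rw [hx.laplaceMap_eq, chartLap_of_sphere hr (hx.contDiffAt_chart hp) (hx.injective_fderiv hp)
      (fun w => hsphere _), Function.comp_apply, extChartAt_to_inv]
    rfl
  have hdL : ∀ (p : M) (X : TangentSpace (𝓡 3) p),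
      differential (laplaceMap g x) p X = (3 / r ^ 2) • differential x p X := by
    intro p X
    have h1 : HasFDerivAt (fun w : Eucl 4 => (3 / r ^ 2) • (w - a))
        ((3 / r ^ 2) • ContinuousLinearMap.id ℝ (Eucl 4)) (x p) :=
      ((hasFDerivAt_id (𝕜 := ℝ) (x p)).sub_const a).const_smul (3 / r ^ 2)
    have h2 := h1.hasMFDerivAt.comp p
      (hx.1.contMDiffAt.mdifferentiableAt (by simp)).hasMFDerivAt
    unfold differential
    rw [hL, h2.mfderiv]
    rfl
  refine ⟨3 / r ^ 2, by positivity, fun p X Y => ?_⟩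
  rw [hdL, hdL, real_inner_smul_left, real_inner_smul_right, hx.2]
  ring

end Global

theorem mainTheorem3 {M : Type*} [TopologicalSpace M] [T2Space M] [SecondCountableTopology M]
    [ConnectedSpace M] [ChartedSpace (Eucl 3) M] [IsManifold (𝓡 3) ∞ M]
    (g : SmoothMetric 3 M) (x : M → Eucl 4) (hx : IsIsometricImmersion g x) :
    HasHomotheticLaplaceTransformation g x ↔ IsOpenPartOfHypersphere x := by
  constructor
  · rintro ⟨c, hc, hL⟩
    obtain ⟨a, ha⟩ := hx.exists_center hc hL
    exact hx.isOpenPartOfHypersphere (Real.sqrt_pos.2 (by positivity)) ha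
  · exact hx.hasHomotheticLaplaceTransformation

end
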